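/- **Proposition (space-reflection symmetry).** Let $d\in\mathbb N$, let $\Gamma\subset\mathbb R^d$ be the lattice generated by a basis $\gamma_1,\dots,\gamma_d$ of $\mathbb R^d$, $\Gamma^*$ its dual lattice with generators $\gamma_j^*$, $\gamma_j^*\cdot\gamma_l=2\pi\delta_{jl}$, and let $Y=\{\sum_l\zeta_l\gamma_l:\zeta_l\in[-\frac12,\frac12]\}$ and $Y^*=\{\sum_l\zeta_l\gamma^*_l:\zeta_l\in[-\frac12,\frac12]\}$ be the centered fundamental domains. Let $\mathcal H_{\rm f}=L^2(Y)=L^2(\mathbb R^d/\Gamma)$, let $\mathcal Z:L^2(\mathbb R^d)\to L^2(Y^*;\mathcal H_{\rm f})$, $(\mathcal Z\psi)(k,y)=\sum_{\gamma\in\Gamma}e^{-i(y+\gamma)\cdot k}\psi(y+\gamma)$, be the Bloch-Floquet-Zak transform, and let $(\mathscr R\psi)(x)=\psi(-x)$ on $L^2(\mathbb R^d)$ and $(\mathscr R_{\rm f}u)(y)=u(-y)$ on $\mathcal H_{\rm f}$ be the space reflections. Let $I\subseteq\mathbb R$ be a set of times with the unique differentiability property (for instance $I=\mathbb R$ or $I=[0,T]$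 with $T>0$). For every $t\in I$ let $H(t)$ be a self-adjoint operator on $L^2(\mathbb R^d)$ that commutes with $\mathscr R$ and such that $\mathcal ZH(t)\mathcal Z^{-1}$ is continuously fibered, i.e. $\mathcal ZH(t)\mathcal Z^{-1}=\int^{\oplus}_{Y^*}H(k,t)\,dk$ with self-adjoint operators $H(k,t)$, $k\in\mathbb R^d$, on $\mathcal H_{\rm f}$ that are equivariant, $H(k+\gamma^*,t)=e^{-iy\cdot\gamma^*}H(k,t)e^{iy\cdot\gamma^*}$ for $\gamma^*\in\Gamma^*$, and for which $k\mapsto(H(k,t)-i)^{-1}$ is norm continuous. Let $P(k,t)$, $k\in\mathbb R^d$, $t\in I$, be either (a) the spectral (Fermi) projector $P(k,t)=\mathbf 1_{(-\infty,E(t))}(H(k,t))$ for some $E:I\to\mathbb R$, or (b) the orthogonal projector onto $\ker(H(k,t)-E_m(k,t))$, where for every $t\in I$ the function $E_m(\cdot,t)$ is an isolated Bloch band: it is continuous on $\mathbb R^d$, $E_m(k,t)$ is an eigenvalue of $H(k,t)$ for every $k$, and $\inf_k\operatorname{dist}\big(E_m(k,t),\sigma(H(k,t))\setminus\{E_m(k,t)\}\big)>0$.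 Then for all $t\in I$ and $k\in\mathbb R^d$ $$P(k,t)=\mathscr R_{\rm f}\,P(-k,t)\,\mathscr R_{\rm f},$$ and the piezocurvature $\Theta=(\Theta_1,\dots,\Theta_d)$, $\Theta_j=-i\operatorname{tr}\big(P\,[\partial_tP,\partial_{k_j}P]\big)$ (derivatives in operator norm; wherever it is defined), satisfies $$\Theta(-k,t)=-\Theta(k,t).$$ Consequently the (leading-order) piezoelectric current $-(2\pi)^{-d}\int_{Y^*}\Theta(k,t)\,dk$ vanishes for every $t\in I$. -/

import Mathlib

open MeasureTheory Set Filter Topology Complex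
open scoped ENNReal

namespace BlochFloquet

noncomputable section

/-! ### Unbounded operators on a Hilbert space -/

section Operators

universe u

variable {K : Type u} [NormedAddCommGroup K] [InnerProductSpace ℂ K] [CompleteSpace K]

/-- The bounded operator `R` is the resolvent `(A - z)⁻¹` of the (unbounded) operator `A`. -/
def IsResolvent (A : K →ₗ.[ℂ] K) (z : ℂ) (R : K →L[ℂ] K) : Prop :=
  (∀ v, (R v, v + z • R v) ∈ A.graph) ∧ ∀ u v, (u, v) ∈ A.graph → R (v - z • u) = u

/-- The spectrum of an (unbounded) operator: the set of all `z` for which `A - z` has no bounded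
everywhere defined two-sided inverse. -/
def opSpectrum (A : K →ₗ.[ℂ] K) : Set ℂ := {z | ¬ ∃ R, IsResolvent A z R}

/-- Projection-valued measures on the Borel sets of `ℝ`; countable additivity is understood in the
strong operator topology. -/
structure PVM (K : Type u) [NormedAddCommGroup K] [InnerProductSpace ℂ K] [CompleteSpace K] where
  toFun : Set ℝ → K →L[ℂ] K
  isStarProjection : ∀ S, MeasurableSet S → IsStarProjection (toFun S)
  map_univ : toFun univ = 1
  map_inter : ∀ S T, MeasurableSet S → MeasurableSet T → toFun (S ∩ T) = toFun S * toFun T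
  hasSum_iUnion : ∀ f : ℕ → Set ℝ, (∀ n, MeasurableSet (f n)) →
    Pairwise (Function.onFun Disjoint f) → ∀ u, HasSum (fun n => toFun (f n) u) (toFun (⋃ n, f n) u)

theorem PVM.inner_eq (F : PVM K) (u : K) {S : Set ℝ} (hS : MeasurableSet S) :
    inner ℂ u (F.toFun S u) = ((‖F.toFun S u‖ ^ 2 : ℝ) : ℂ) := by
  have h := F.isStarProjection S hS
  have h2 : F.toFun S (F.toFun S u) = F.toFun S u := by
    have := congrArg (fun T : K →L[ℂ] K => T u) h.isIdempotentElem.eq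
    simpa using this
  have h3 : ContinuousLinearMap.adjoint (F.toFun S) = F.toFun S := h.isSelfAdjoint
  have h4 := ContinuousLinearMap.adjoint_inner_right (F.toFun S) u (F.toFun S u)
  rw [h3, h2, inner_self_eq_norm_sq_to_K] at h4
  rw [h4]
  push_cast
  rfl

/-- The scalar spectral measure `S ↦ ⟨u, F(S) u⟩ = ‖F(S) u‖ ^ 2` of a projection-valued measure. -/
def PVM.scalar (F : PVM K) (u : K) : Measure ℝ :=
  Measure.ofMeasurable (fun S _ => ENNReal.ofReal (‖F.toFun S u‖ ^ 2))
    (by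
      have h := F.hasSum_iUnion (fun _ => ∅) (fun _ => MeasurableSet.empty)
        (fun _ _ _ => by simp [Function.onFun]) u
      have h0 : F.toFun ∅ u = 0 :=
        tendsto_nhds_unique tendsto_const_nhds h.summable.tendsto_atTop_zero
      simp [h0])
    (by
      intro f hf hd
      have h := (F.hasSum_iUnion f hf hd u).mapL (innerSL ℂ u)
      simp only [innerSL_apply_apply] at h
      rw [F.inner_eq u (MeasurableSet.iUnion hf)] at h
      simp only [F.inner_eq u (hf _)] at h
      have h' := Complex.hasSum_ofReal.1 h
      rw [← h'.tsum_eq, ENNReal.ofReal_tsum_of_nonneg (fun n => by positivity) h'.summable])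

/-- `A = ∫ x dF(x)`: the domain of `A` consists of all `u` with `∫ x² d⟨u, F(x) u⟩ < ∞`, and
`⟨u, A u⟩ = ∫ x d⟨u, F(x) u⟩` for every `u` in it (by polarization this determines `A`). -/
def IsSpectralMeasure (A : K →ₗ.[ℂ] K) (F : PVM K) : Prop :=
  (∀ u, u ∈ A.domain ↔ ∫⁻ x, ENNReal.ofReal (x ^ 2) ∂(F.scalar u) < ∞) ∧
  ∀ u : A.domain, inner ℂ (u : K) (A u) = ((∫ x, x ∂(F.scalar (u : K)) : ℝ) : ℂ)

/-- `P` is the spectral projection `1_S(A)` of the self-adjoint operator `A`. -/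
def IsSpectralProjection (A : K →ₗ.[ℂ] K) (S : Set ℝ) (P : K →L[ℂ] K) : Prop :=
  ∃ F : PVM K, IsSpectralMeasure A F ∧ P = F.toFun S

/-- `P` is the orthogonal projection onto the eigenspace `ker (A - e)`. -/
def IsEigenprojection (A : K →ₗ.[ℂ] K) (e : ℝ) (P : K →L[ℂ] K) : Prop :=
  IsStarProjection P ∧ ∀ u, P u = u ↔ (u, (e : ℂ) • u) ∈ A.graph

/-- The bounded operator `A` has trace `τ`: its diagonal sum converges unconditionally to `τ` in
every orthonormal basis. Such a `τ` exists exactly for the trace class operators. -/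
def HasTrace (A : K →L[ℂ] K) (τ : ℂ) : Prop :=
  ∀ (ι : Type u) (b : HilbertBasis ι ℂ K), HasSum (fun i => inner ℂ (b i) (A (b i))) τ

open Classical in
/-- The trace of a trace class operator (`0` if the operator is not trace class). -/
def trace (A : K →L[ℂ] K) : ℂ := if h : ∃ τ, HasTrace A τ then h.choose else 0

end Operators

/-! ### Lattices, function spaces, space reflection -/

variable {d : ℕ}

/-- The position space (and the momentum space). -/
abbrev Space (d : ℕ) := EuclideanSpace ℝ (Fin d)

/-- The point with integer coordinates `n` of the lattice generated by `v`. -/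
def latticePoint (v : Fin d → Space d) (n : Fin d → ℤ) : Space d := ∑ l, (n l : ℝ) • v l

/-- The centered fundamental domain `{∑ ζ_l v_l : ζ_l ∈ [-1/2, 1/2]}`. -/
def cell (v : Fin d → Space d) : Set (Space d) :=
  {x | ∃ ζ : Fin d → ℝ, (∀ l, ζ l ∈ Icc (-(1 / 2) : ℝ) (1 / 2)) ∧ x = ∑ l, ζ l • v l}

/-- The generators `γ*_j` of the dual lattice, `⟨γ*_j, γ_l⟩ = 2π δ_{jl}`. -/
def dualGen (γ : Module.Basis (Fin d) ℝ (Space d)) (j : Fin d) : Space d :=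
  (2 * Real.pi) • (InnerProductSpace.toDual ℝ (Space d)).symm
    (LinearMap.toContinuousLinearMap (γ.coord j))

theorem inner_dualGen (γ : Module.Basis (Fin d) ℝ (Space d)) (j l : Fin d) :
    inner ℝ (dualGen γ j) (γ l) = if j = l then 2 * Real.pi else 0 := by
  simp [dualGen, inner_smul_left, Finsupp.single_apply, eq_comm]

/-- The first Brillouin zone `Y*`. -/
def brillouin (γ : Module.Basis (Fin d) ℝ (Space d)) : Set (Space d) := cell (dualGen γ)

/-- `L²(ℝ^d)`. -/
abbrev L2Space (d : ℕ) := Lp ℂ 2 (volume : Measure (Space d))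

/-- The fibre space `L²(Y)`, that is, `L²` of the torus `ℝ^d / Γ`. -/
abbrev Fiber (γ : Module.Basis (Fin d) ℝ (Space d)) :=
  Lp ℂ 2 ((volume : Measure (Space d)).restrict (cell γ))

theorem neg_preimage_cell (v : Fin d → Space d) : (fun x : Space d => -x) ⁻¹' cell v = cell v := by
  ext x
  constructor
  · rintro ⟨ζ, hζ, h⟩
    refine ⟨fun l => -ζ l, fun l => ⟨by linarith [(hζ l).2], by linarith [(hζ l).1]⟩, ?_⟩
    simp only [neg_smul, Finset.sum_neg_distrib, ← h, neg_neg]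
  · rintro ⟨ζ, hζ, h⟩
    refine ⟨fun l => -ζ l, fun l => ⟨by linarith [(hζ l).2], by linarith [(hζ l).1]⟩, ?_⟩
    simp only [neg_smul, Finset.sum_neg_distrib, ← h]

theorem measurePreserving_neg_cell (v : Fin d → Space d) :
    MeasurePreserving (fun x : Space d => -x) (volume.restrict (cell v))
      (volume.restrict (cell v)) := by
  have h := (Measure.measurePreserving_neg (volume : Measure (Space d))).restrict_preimage_emb
    (MeasurableEquiv.neg (Space d)).measurableEmbedding (cell v)
  have h2 : (Neg.neg ⁻¹' cell v : Set (Space d)) = cell v := neg_preimage_cell v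
  rwa [h2] at h

/-- Space reflection `(R ψ)(x) = ψ(-x)` in `L²(ℝ^d)`. -/
def reflection (d : ℕ) : L2Space d →L[ℂ] L2Space d :=
  (Lp.compMeasurePreservingₗᵢ ℂ (fun x : Space d => -x)
    (Measure.measurePreserving_neg volume)).toContinuousLinearMap

/-- Space reflection `(R_f u)(y) = u(-y)` in the fibre space. -/
def fiberReflection (γ : Module.Basis (Fin d) ℝ (Space d)) : Fiber γ →L[ℂ] Fiber γ :=
  (Lp.compMeasurePreservingₗᵢ ℂ (fun x : Space d => -x)
    (measurePreserving_neg_cell γ)).toContinuousLinearMap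

/-- The (unbounded) operator `A` commutes with the space reflection. -/
def CommutesWithReflection (A : L2Space d →ₗ.[ℂ] L2Space d) : Prop :=
  ∀ ψ φ, (ψ, φ) ∈ A.graph → (reflection d ψ, reflection d φ) ∈ A.graph

/-! ### The Bloch-Floquet-Zak transform and fibred operators -/

theorem memLp_phase {μ : Measure (Space d)} {f : Space d → ℂ} (hf : MemLp f 2 μ) (a k : Space d) :
    MemLp (fun y => cexp (-(I * (inner ℝ (y + a) k : ℝ))) * f y) 2 μ := by
  refine hf.of_le (AEStronglyMeasurable.mul (Continuous.aestronglyMeasurable (by fun_prop)) hf.1)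
    (Eventually.of_forall fun y => ?_)
  rw [norm_mul, ← mul_neg, mul_comm I, ← ofReal_neg, norm_exp_ofReal_mul_I, one_mul]

theorem memLp_translate (γ : Module.Basis (Fin d) ℝ (Space d)) (ψ : L2Space d) (a : Space d) :
    MemLp (fun y => ψ (y + a)) 2 ((volume : Measure (Space d)).restrict (cell γ)) :=
  ((Lp.memLp ψ).comp_measurePreserving (measurePreserving_add_right volume a)).restrict _

/-- Multiplication by `y ↦ exp (-i y·κ)` in the fibre space. -/
def phase (γ : Module.Basis (Fin d) ℝ (Space d)) (κ : Space d) (u : Fiber γ) : Fiber γ :=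
  (memLp_phase (Lp.memLp u) 0 κ).toLp _

/-- The term `y ↦ exp (-i (y + a)·k) ψ(y + a)` of the Bloch-Floquet-Zak transform, for the lattice
vector `a` with coordinates `n`. -/
def zakTerm (γ : Module.Basis (Fin d) ℝ (Space d)) (ψ : L2Space d) (n : Fin d → ℤ) (k : Space d) :
    Fiber γ :=
  (memLp_phase (memLp_translate γ ψ (latticePoint γ n)) (latticePoint γ n) k).toLp _

/-- `Ψ` is (a representative of) the Bloch-Floquet-Zak transform
`(Z ψ)(k, y) = ∑_{a ∈ Γ} exp (-i (y + a)·k) ψ(y + a)` of `ψ`, where the series converges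
(unconditionally) in `L²(Y*; L²(Y))`. -/
def IsZakTransform (γ : Module.Basis (Fin d) ℝ (Space d)) (ψ : L2Space d)
    (Ψ : Space d → Fiber γ) : Prop :=
  AEStronglyMeasurable Ψ (volume.restrict (brillouin γ)) ∧
  Tendsto (fun s : Finset (Fin d → ℤ) =>
    eLpNorm (fun k => Ψ k - ∑ n ∈ s, zakTerm γ ψ n k) 2 (volume.restrict (brillouin γ)))
    atTop (𝓝 0)

/-- `Z H Z⁻¹` is the direct integral over `Y*` of the self-adjoint operators `h k`, and this
fibration is continuous: the family `h`, extended to all `k ∈ ℝ^d` in the `τ`-equivariant way, is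
continuous in the norm resolvent sense. The direct integral is expressed through graphs:
`ψ ∈ D(H)` and `H ψ = φ` if and only if `(Z ψ)(k) ∈ D(h k)` and `h k (Z ψ)(k) = (Z φ)(k)` for
almost every `k ∈ Y*`. Equivariance reads `h (k + κ) = τ h k τ⁻¹` for `κ` in the dual lattice, with
`τ` the multiplication by `exp (-i y·κ)`. -/
structure IsContinuouslyFibered (γ : Module.Basis (Fin d) ℝ (Space d))
    (H : L2Space d →ₗ.[ℂ] L2Space d) (h : Space d → Fiber γ →ₗ.[ℂ] Fiber γ) : Prop where
  selfAdjoint : ∀ k, IsSelfAdjoint (h k)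
  directIntegral : ∀ ψ φ Ψ Φ, IsZakTransform γ ψ Ψ → IsZakTransform γ φ Φ →
    ((ψ, φ) ∈ H.graph ↔ ∀ᵐ k ∂(volume.restrict (brillouin γ)), (Ψ k, Φ k) ∈ (h k).graph)
  equivariant : ∀ k n u v, (u, v) ∈ (h k).graph →
    (phase γ (latticePoint (dualGen γ) n) u, phase γ (latticePoint (dualGen γ) n) v) ∈
      (h (k + latticePoint (dualGen γ) n)).graph
  continuous : ∃ res : Space d → Fiber γ →L[ℂ] Fiber γ,
    Continuous res ∧ ∀ k, IsResolvent (h k) I (res k)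

/-- `e` is an isolated Bloch band of the fibred operator: a continuous family of eigenvalues which
is separated from the rest of the spectrum by a gap, uniformly in `k`. -/
structure IsIsolatedBand {γ : Module.Basis (Fin d) ℝ (Space d)}
    (h : Space d → Fiber γ →ₗ.[ℂ] Fiber γ) (e : Space d → ℝ) : Prop where
  continuous : Continuous e
  eigenvalue : ∀ k, ∃ u : Fiber γ, u ≠ 0 ∧ (u, (e k : ℂ) • u) ∈ (h k).graph
  gap : ∃ g > 0, ∀ k, ∀ x : ℝ, (x : ℂ) ∈ opSpectrum (h k) → x ≠ e k → g ≤ |x - e k|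

/-! ### Piezocurvature and piezoelectric current -/

/-- The piezocurvature `Θ_j = -i tr (P [∂_t P, ∂_{k_j} P])`, `j = 1, …, d`; the time derivative is
taken within the time set `J`. -/
def piezocurvature {γ : Module.Basis (Fin d) ℝ (Space d)} (J : Set ℝ)
    (P : Space d → ℝ → Fiber γ →L[ℂ] Fiber γ) (k : Space d) (t : ℝ) : Fin d → ℂ := fun j =>
  let Pt := derivWithin (fun s => P k s) J t;
  let Pj := lineDeriv ℝ (fun q => P q t) k (EuclideanSpace.single j 1);
  -I * trace (P k t * (Pt * Pj - Pj * Pt))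

/-- The piezoelectric current `-(2π)^{-d} ∫_{Y*} Θ(k, t) dk`. -/
def piezoCurrent {γ : Module.Basis (Fin d) ℝ (Space d)} (J : Set ℝ)
    (P : Space d → ℝ → Fiber γ →L[ℂ] Fiber γ) (t : ℝ) : Fin d → ℂ :=
  -(((2 * Real.pi) ^ d)⁻¹ : ℝ) • ∫ k in brillouin γ, piezocurvature J P k t

end

end BlochFloquet

open BlochFloquet

/-!
The Zak transform turns the reflection `R` of `L²(ℝ^d)` into the fibre reflection `R_f` combined
with `k ↦ -k`. Since `H(t)` commutes with `R`, the resolvents of `R_f H(k,t) R_f` and `H(-k,t)`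
agree for almost every `k`, hence for every `k` by norm continuity and equivariance.

A bounded operator `J` that intertwines self-adjoint operators with spectral measures `F` and `G`
intertwines `F` and `G`: for `b < E`, an operator norm estimate on `G([E, ∞)) J F([a, b])` forces
it to vanish, and `J F((-∞, E)) = G((-∞, E)) J` follows by passing to the limit and to adjoints.
In the band case one also needs `E_m(-k,t) = E_m(k,t)`: both are eigenvalues of `H(-k,t)`, so the
set of `k` where they agree is open by the gap; it is closed by continuity and contains `0`.

Finally, conjugation by `R_f` preserves the trace and commutes with `∂_t`, whereas `∂_{k_j}`
picks up a sign because `k` is reflected; so `Θ` is odd and integrates to zero over the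
reflection-invariant cell `Y*`.
-/

namespace BlochFloquet

noncomputable section

/-! ### Self-adjoint operators -/

section SelfAdjoint

theorem mem_graph_iff_forall_inner {𝕜 K : Type*} [RCLike 𝕜] [NormedAddCommGroup K]
    [InnerProductSpace 𝕜 K] [CompleteSpace K] {A : K →ₗ.[𝕜] K} (hA : IsSelfAdjoint A) {u v : K} :
    (u, v) ∈ A.graph ↔ ∀ u' v', (u', v') ∈ A.graph → inner 𝕜 v' u = inner 𝕜 u' v := by
  have hgraph := LinearPMap.adjoint_graph_eq_graph_adjoint hA.dense_domain
  rw [LinearPMap.isSelfAdjoint_def.1 hA] at hgraph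
  conv_lhs => rw [hgraph]
  simp only [Submodule.mem_adjoint_iff, sub_eq_zero]

variable {K : Type*} [NormedAddCommGroup K] [InnerProductSpace ℂ K] [CompleteSpace K]
  {A : K →ₗ.[ℂ] K}

theorem norm_sub_I_smul_sq (hA : IsSelfAdjoint A) {u v : K} (h : (u, v) ∈ A.graph) :
    ‖v - I • u‖ ^ 2 = ‖v‖ ^ 2 + ‖u‖ ^ 2 := by
  have him : (inner ℂ v u).im = 0 := by
    rw [← conj_eq_iff_im, inner_conj_symm]
    exact ((mem_graph_iff_forall_inner hA).1 h u v h).symm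
  simp [@norm_sub_sq ℂ, inner_smul_right, norm_smul, him]

theorem eq_zero_of_forall_inner_sub_I_smul_eq_zero (hA : IsSelfAdjoint A) {x : K}
    (hx : ∀ u v, (u, v) ∈ A.graph → inner ℂ (v - I • u) x = 0) : x = 0 := by
  have hgraph : (x, -I • x) ∈ A.graph := by
    refine (mem_graph_iff_forall_inner hA).2 fun u v h => ?_
    have := hx u v h
    rw [inner_sub_left, sub_eq_zero, inner_smul_left, conj_I] at this
    rw [this, inner_smul_right]
  have hnorm := norm_sub_I_smul_sq hA hgraph
  rw [show -I • x - I • x = (-2 * I) • x by module] at hnorm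
  simp only [neg_mul, neg_smul, norm_neg, norm_smul, norm_mul, Complex.norm_ofNat, norm_I,
    mul_one, one_mul] at hnorm
  rw [← norm_eq_zero, ← sq_eq_zero_iff]
  linarith

theorem isClosed_range_sub_I_smul (hA : IsSelfAdjoint A) :
    IsClosed {w : K | ∃ u, (u, w + I • u) ∈ A.graph} := by
  let M : A.graph →L[ℂ] K :=
    (ContinuousLinearMap.snd ℂ K K - I • ContinuousLinearMap.fst ℂ K K).comp A.graph.subtypeL
  have : CompleteSpace A.graph := hA.isClosed.completeSpace_coe
  have hM : AntilipschitzWith 1 M := by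
    refine AddMonoidHomClass.antilipschitz_of_bound M fun ⟨⟨u, v⟩, h⟩ => ?_
    have hnorm := norm_sub_I_smul_sq hA h
    have hu : ‖u‖ ≤ ‖v - I • u‖ :=
      le_of_sq_le_sq (by linarith [sq_nonneg ‖v‖]) (norm_nonneg _)
    have hv : ‖v‖ ≤ ‖v - I • u‖ :=
      le_of_sq_le_sq (by linarith [sq_nonneg ‖u‖]) (norm_nonneg _)
    simpa [M, Prod.norm_def] using ⟨hu, hv⟩
  convert hM.isClosed_range M.uniformContinuous using 1
  ext w
  constructor
  · rintro ⟨u, h⟩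
    exact ⟨⟨_, h⟩, by simp [M]⟩
  · rintro ⟨⟨⟨u, v⟩, h⟩, rfl⟩
    exact ⟨u, by simpa [M] using h⟩

theorem exists_mem_graph_add_I_smul (hA : IsSelfAdjoint A) (w : K) :
    ∃ u, (u, w + I • u) ∈ A.graph := by
  let R : Submodule ℂ K :=
    A.graph.map (LinearMap.snd ℂ K K - I • LinearMap.fst ℂ K K)
  have hR : ∀ x, x ∈ R ↔ ∃ u, (u, x + I • u) ∈ A.graph := by
    intro x
    constructor
    · rintro ⟨⟨u, v⟩, h, rfl⟩
      exact ⟨u, by simpa using h⟩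
    · rintro ⟨u, h⟩
      exact ⟨_, h, by simp⟩
  have hclosed : IsClosed (R : Set K) := by
    convert isClosed_range_sub_I_smul hA using 1
    exact Set.ext hR
  have : CompleteSpace R := hclosed.completeSpace_coe
  have hbot : Rᗮ = ⊥ := (Submodule.eq_bot_iff _).2 fun x hx =>
    eq_zero_of_forall_inner_sub_I_smul_eq_zero hA fun u v h =>
      (Submodule.mem_orthogonal _ _).1 hx _ ⟨(u, v), h, by simp⟩
  rw [← hR, (Submodule.orthogonal_eq_bot_iff).1 hbot]
  exact Submodule.mem_top

end SelfAdjoint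

section Intertwines

variable {K L : Type*} [NormedAddCommGroup K] [InnerProductSpace ℂ K] [NormedAddCommGroup L]
  [InnerProductSpace ℂ L] {A : K →ₗ.[ℂ] K} {B : L →ₗ.[ℂ] L} {J : K →L[ℂ] L}

/-- The bounded operator `J` intertwines the unbounded operators `A` and `B`, that is,
`J A ⊆ B J`; in particular `J` maps the domain of `A` into the domain of `B`. -/
def Intertwines (J : K →L[ℂ] L) (A : K →ₗ.[ℂ] K) (B : L →ₗ.[ℂ] L) : Prop :=
  ∀ ⦃u v⦄, (u, v) ∈ A.graph → (J u, J v) ∈ B.graph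

theorem Intertwines.adjoint [CompleteSpace K] [CompleteSpace L] (hJ : Intertwines J A B)
    (hA : IsSelfAdjoint A) (hB : IsSelfAdjoint B) :
    Intertwines (ContinuousLinearMap.adjoint J) B A := fun u v h =>
  (mem_graph_iff_forall_inner hA).2 fun u' v' h' => by
    simpa only [ContinuousLinearMap.adjoint_inner_right] using
      (mem_graph_iff_forall_inner hB).1 h _ _ (hJ h')

end Intertwines

/-! ### Projection-valued measures -/

section Spectral

universe u v

variable {K : Type u} [NormedAddCommGroup K] [InnerProductSpace ℂ K] [CompleteSpace K]

namespace PVM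

variable (F : PVM K) {S T : Set ℝ}

open Classical in
/-- The vector-valued measure `S ↦ F(S) u` (which vanishes on the non-measurable sets, where
`F.toFun` is unconstrained). -/
def vectorMeasure (u : K) : VectorMeasure ℝ K where
  measureOf' S := if MeasurableSet S then F.toFun S u else 0
  empty' := by
    have h := F.hasSum_iUnion (fun _ => ∅) (fun _ => MeasurableSet.empty)
      (fun _ _ _ => disjoint_bot_left) u
    rw [if_pos MeasurableSet.empty]
    simpa using tendsto_nhds_unique tendsto_const_nhds h.summable.tendsto_atTop_zero
  not_measurable' _ hS := if_neg hS
  m_iUnion' f hf hd := by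
    simpa only [hf, MeasurableSet.iUnion hf, if_true] using F.hasSum_iUnion f hf hd u

theorem vectorMeasure_apply (hS : MeasurableSet S) (u : K) : F.vectorMeasure u S = F.toFun S u :=
  if_pos hS

theorem map_compl (hS : MeasurableSet S) : F.toFun Sᶜ = 1 - F.toFun S := by
  ext u
  have h := VectorMeasure.of_compl (v := F.vectorMeasure u) hS
  rw [vectorMeasure_apply _ hS.compl, vectorMeasure_apply _ hS,
    vectorMeasure_apply _ MeasurableSet.univ, F.map_univ] at h
  exact h

theorem map_apply_map (hS : MeasurableSet S) (u : K) : F.toFun S (F.toFun S u) = F.toFun S u :=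
  DFunLike.congr_fun (F.isStarProjection S hS).isIdempotentElem.eq u

theorem map_apply_comm (hS : MeasurableSet S) (hT : MeasurableSet T) (u : K) :
    F.toFun S (F.toFun T u) = F.toFun T (F.toFun S u) := by
  have h := F.map_inter S T hS hT
  rw [inter_comm, F.map_inter T S hT hS] at h
  exact DFunLike.congr_fun h.symm u

theorem inner_map_left (hS : MeasurableSet S) (u v : K) :
    inner ℂ (F.toFun S u) v = inner ℂ u (F.toFun S v) :=
  (F.isStarProjection S hS).isSelfAdjoint.isSymmetric u v

theorem norm_map_apply_le (hS : MeasurableSet S) (u : K) : ‖F.toFun S u‖ ≤ ‖u‖ :=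
  (F.toFun S).le_of_opNorm_le_of_le (F.isStarProjection S hS).norm_le le_rfl |>.trans_eq (one_mul _)

theorem scalar_apply (u : K) (hS : MeasurableSet S) :
    F.scalar u S = ENNReal.ofReal (‖F.toFun S u‖ ^ 2) :=
  Measure.ofMeasurable_apply S hS

theorem scalar_univ (u : K) : F.scalar u univ = ENNReal.ofReal (‖u‖ ^ 2) := by
  rw [F.scalar_apply u MeasurableSet.univ, F.map_univ]; rfl

theorem scalar_real_univ (u : K) : (F.scalar u).real univ = ‖u‖ ^ 2 := by
  rw [measureReal_def, F.scalar_univ, ENNReal.toReal_ofReal (by positivity)]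

instance isFiniteMeasure_scalar (u : K) : IsFiniteMeasure (F.scalar u) :=
  ⟨by rw [F.scalar_univ]; exact ENNReal.ofReal_lt_top⟩

theorem scalar_map (u : K) (hS : MeasurableSet S) :
    F.scalar (F.toFun S u) = (F.scalar u).restrict S := by
  ext T hT
  rw [Measure.restrict_apply hT, F.scalar_apply _ hT, F.scalar_apply _ (hT.inter hS),
    F.map_inter T S hT hS]
  rfl

theorem ae_mem_of_map_eq_self {u : K} (hS : MeasurableSet S) (hu : F.toFun S u = u) :
    ∀ᵐ x ∂(F.scalar u), x ∈ S := by
  rw [← hu, F.scalar_map u hS]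
  exact ae_restrict_mem hS

theorem scalar_add (hT : MeasurableSet T) {u v : K} (hu : F.toFun T u = u)
    (hv : F.toFun T v = 0) : F.scalar (u + v) = F.scalar u + F.scalar v := by
  ext S hS
  have horth : inner ℂ (F.toFun S u) (F.toFun S v) = 0 := by
    rw [← hu, F.map_apply_comm hS hT, F.inner_map_left hT, F.map_apply_comm hT hS, hv, map_zero,
      inner_zero_right]
  have hpyth := norm_add_sq_eq_norm_sq_add_norm_sq_of_inner_eq_zero _ _ horth
  simp only [← pow_two] at hpyth
  rw [Measure.add_apply, F.scalar_apply _ hS, F.scalar_apply _ hS, F.scalar_apply _ hS,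
    ← ENNReal.ofReal_add (by positivity) (by positivity), map_add, hpyth]

end PVM

/-! ### Spectral measures of self-adjoint operators -/

theorem exists_monotone_Icc_iUnion_eq_Iio (E : ℝ) :
    ∃ a b : ℕ → ℝ, (Monotone fun n => Icc (a n) (b n)) ∧ (∀ n, a n ≤ b n ∧ b n < E) ∧
      ⋃ n, Icc (a n) (b n) = Iio E := by
  obtain ⟨b, hb, hbE, hlim⟩ := exists_seq_strictMono_tendsto E
  have hIci : Monotone fun n : ℕ => Ici (b 0 - n) := fun m n hmn =>
    Ici_subset_Ici.2 (by gcongr)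
  have hIic : Monotone fun n => Iic (b n) := fun m n hmn => Iic_subset_Iic.2 (hb.monotone hmn)
  refine ⟨fun n => b 0 - n, b, fun m n hmn => inter_subset_inter (hIci hmn) (hIic hmn),
    fun n => ⟨?_, hbE n⟩, ?_⟩
  · linarith [hb.monotone (Nat.zero_le n), n.cast_nonneg (α := ℝ)]
  · have hbot : ⋃ n : ℕ, Ici (b 0 - n) = univ := eq_univ_of_forall fun x => by
      obtain ⟨n, hn⟩ := exists_nat_ge (b 0 - x)
      exact mem_iUnion.2 ⟨n, sub_le_comm.1 hn⟩
    simp only [← Ici_inter_Iic]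
    rw [iUnion_inter_of_monotone hIci hIic, hbot, univ_inter,
      iUnion_Iic_eq_Iio_of_lt_of_tendsto hbE hlim]

namespace IsSpectralMeasure

variable {A : K →ₗ.[ℂ] K} {F : PVM K} (hF : IsSpectralMeasure A F) {S : Set ℝ}
include hF

theorem integrable_id {u v : K} (h : (u, v) ∈ A.graph) :
    Integrable (fun x : ℝ => x) (F.scalar u) := by
  have hsq : MemLp (fun x : ℝ => x) 2 (F.scalar u) := by
    rw [memLp_two_iff_integrable_sq (by fun_prop)]
    refine ⟨by fun_prop, ?_⟩
    rw [hasFiniteIntegral_iff_ofReal (Eventually.of_forall fun x => sq_nonneg x)]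
    exact (hF.1 u).1 (LinearPMap.mem_domain_of_mem_graph h)
  exact hsq.integrable (by norm_num)

theorem inner_eq_integral {u v : K} (h : (u, v) ∈ A.graph) :
    inner ℂ u v = ((∫ x, x ∂(F.scalar u) : ℝ) : ℂ) := by
  obtain ⟨x, rfl, rfl⟩ := (LinearPMap.mem_graph_iff A).1 h
  exact hF.2 x

theorem inner_sub_smul_eq_integral {u v : K} (h : (u, v) ∈ A.graph) (c : ℝ) :
    inner ℂ u (v - (c : ℂ) • u) = ((∫ x, (x - c) ∂(F.scalar u) : ℝ) : ℂ) := by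
  rw [inner_sub_right, inner_smul_right, hF.inner_eq_integral h,
    integral_sub (hF.integrable_id h) (integrable_const c), integral_const, F.scalar_real_univ,
    inner_self_eq_norm_sq_to_K, smul_eq_mul]
  push_cast
  rw [mul_comm]
  rfl

theorem map_mem_domain {u : K} (hu : u ∈ A.domain) (hS : MeasurableSet S) :
    F.toFun S u ∈ A.domain := by
  rw [hF.1, F.scalar_map u hS]
  exact (setLIntegral_le_lintegral _ _).trans_lt ((hF.1 u).1 hu)

theorem map_mem_domain_of_isBounded (hS : MeasurableSet S) (hb : Bornology.IsBounded S) (u : K) :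
    F.toFun S u ∈ A.domain := by
  obtain ⟨r, hr⟩ := isBounded_iff_forall_norm_le.1 hb
  rw [hF.1, F.scalar_map u hS]
  calc ∫⁻ x in S, ENNReal.ofReal (x ^ 2) ∂(F.scalar u)
      ≤ ∫⁻ _ in S, ENNReal.ofReal (r ^ 2) ∂(F.scalar u) :=
        setLIntegral_mono' hS fun x hx => ENNReal.ofReal_le_ofReal <|
          sq_le_sq.2 <| (hr x hx).trans (le_abs_self r)
    _ < ∞ := by
        rw [setLIntegral_const]
        exact ENNReal.mul_lt_top ENNReal.ofReal_lt_top (measure_lt_top _ _)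

theorem inner_add_inner_eq_zero (hS : MeasurableSet S) {u v u' v' : K} (h : (u, v) ∈ A.graph)
    (h' : (u', v') ∈ A.graph) (hu : F.toFun S u = u) (hu' : F.toFun S u' = 0) :
    inner ℂ u v' + inner ℂ u' v = 0 := by
  have hsum := hF.inner_eq_integral (A.graph.add_mem h h')
  rw [F.scalar_add hS hu hu', integral_add_measure (hF.integrable_id h) (hF.integrable_id h'),
    ofReal_add, ← hF.inner_eq_integral h, ← hF.inner_eq_integral h'] at hsum
  simp only [inner_add_left, inner_add_right] at hsum
  linear_combination hsum

theorem inner_eq_zero (hS : MeasurableSet S) {u v u' v' : K} (h : (u, v) ∈ A.graph)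
    (h' : (u', v') ∈ A.graph) (hu : F.toFun S u = u) (hu' : F.toFun S u' = 0) :
    inner ℂ u' v = 0 := by
  have hre := hF.inner_add_inner_eq_zero hS h h' hu hu'
  have him := hF.inner_add_inner_eq_zero hS h (A.graph.smul_mem I h') hu (by simp [hu'])
  rw [inner_smul_right, inner_smul_left, conj_I] at him
  linear_combination (hre + I * him) / 2 + (inner ℂ u' v - inner ℂ u v') / 2 * I_mul_I

theorem map_eq_self_of_mem_graph (hA : IsSelfAdjoint A) (hS : MeasurableSet S) {u v : K}
    (h : (u, v) ∈ A.graph) (hu : F.toFun S u = u) : F.toFun S v = v := by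
  have hv : F.toFun Sᶜ v = 0 := by
    refine hA.dense_domain.eq_zero_of_inner_right ℂ fun x hx => ?_
    obtain ⟨w, hw⟩ := LinearPMap.mem_domain_iff.1 (hF.map_mem_domain hx hS.compl)
    rw [← F.inner_map_left hS.compl]
    refine hF.inner_eq_zero hS h hw hu ?_
    rw [F.map_compl hS]
    simp [F.map_apply_map hS]
  rw [F.map_compl hS] at hv
  exact (sub_eq_zero.1 hv).symm

theorem map_mem_graph (hA : IsSelfAdjoint A) (hS : MeasurableSet S) {u v : K}
    (h : (u, v) ∈ A.graph) : (F.toFun S u, F.toFun S v) ∈ A.graph := by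
  obtain ⟨w, hw⟩ := LinearPMap.mem_domain_iff.1
    (hF.map_mem_domain (LinearPMap.mem_domain_of_mem_graph h) hS)
  have hwS : F.toFun S w = w := hF.map_eq_self_of_mem_graph hA hS hw (F.map_apply_map hS u)
  have hcompl : (F.toFun Sᶜ u, v - w) ∈ A.graph := by
    rw [F.map_compl hS]
    exact A.graph.sub_mem h hw
  have hvS := hF.map_eq_self_of_mem_graph hA hS.compl hcompl (F.map_apply_map hS.compl u)
  rw [F.map_compl hS] at hvS
  have hv : F.toFun S (v - w) = 0 := sub_eq_self.1 hvS
  rw [map_sub, hwS, sub_eq_zero] at hv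
  rwa [hv]

theorem abs_re_inner_sub_smul_le (hS : MeasurableSet S) {c r : ℝ}
    (hr : S ⊆ Metric.closedBall c r) {u v : K} (h : (u, v) ∈ A.graph) (hu : F.toFun S u = u) :
    |(inner ℂ u (v - (c : ℂ) • u)).re| ≤ r * ‖u‖ ^ 2 := by
  rw [hF.inner_sub_smul_eq_integral h, ofReal_re, ← F.scalar_real_univ]
  have hae : ∀ᵐ x ∂(F.scalar u), ‖x - c‖ ≤ r :=
    (F.ae_mem_of_map_eq_self hS hu).mono fun x hx => mem_closedBall_iff_norm.1 (hr hx)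
  exact norm_integral_le_of_norm_le_const hae

/-- The bounded operator is `(A - c) F(S)`; being symmetric, its norm is the supremum of its
Rayleigh quotients. -/
theorem exists_norm_le_of_subset_closedBall (hA : IsSelfAdjoint A) (hS : MeasurableSet S)
    {c r : ℝ} (hr₀ : 0 ≤ r) (hr : S ⊆ Metric.closedBall c r) :
    ∃ C : K →L[ℂ] K, ‖C‖ ≤ r ∧ (∀ u, F.toFun S (C u) = C u) ∧
      ∀ u, (F.toFun S u, C u + (c : ℂ) • F.toFun S u) ∈ A.graph := by
  let D : K →ₗ[ℂ] A.domain := LinearMap.codRestrict A.domain (F.toFun S)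
    (hF.map_mem_domain_of_isBounded hS (Metric.isBounded_closedBall.subset hr))
  let C₀ : K →ₗ[ℂ] K := A.toFun ∘ₗ D - (c : ℂ) • (F.toFun S : K →ₗ[ℂ] K)
  have hgraph : ∀ u, (F.toFun S u, C₀ u + (c : ℂ) • F.toFun S u) ∈ A.graph := fun u => by
    simpa [C₀, D] using A.mem_graph (D u)
  have hrange : ∀ u, F.toFun S (C₀ u) = C₀ u := fun u => by
    have h := hF.map_eq_self_of_mem_graph hA hS (hgraph u) (F.map_apply_map hS u)
    rw [map_add, map_smul, F.map_apply_map hS] at h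
    exact add_right_cancel h
  have hinner : ∀ u v, inner ℂ (C₀ u) v = inner ℂ (C₀ u) (F.toFun S v) := fun u v => by
    rw [← F.inner_map_left hS, hrange]
  have hsymm : C₀.IsSymmetric := fun u v => by
    have h := (mem_graph_iff_forall_inner hA).1 (hgraph v) _ _ (hgraph u)
    rw [inner_add_left, inner_add_right, inner_smul_left, inner_smul_right, conj_ofReal,
      add_left_inj, ← hinner] at h
    rw [h, F.inner_map_left hS, hrange]
  let C : K →L[ℂ] K := ⟨C₀, hsymm.continuous⟩
  refine ⟨C, ?_, hrange, hgraph⟩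
  rw [ContinuousLinearMap.norm_eq_iSup_rayleighQuotient C hsymm]
  refine ciSup_le fun u => ?_
  have hquad : |(inner ℂ (C u) u).re| ≤ r * ‖u‖ ^ 2 := by
    have h := hF.abs_re_inner_sub_smul_le hS hr (hgraph u) (F.map_apply_map hS u)
    rw [add_sub_cancel_right, ← inner_conj_symm, ← hinner, conj_re] at h
    exact h.trans (by gcongr; exact F.norm_map_apply_le hS u)
  rw [ContinuousLinearMap.rayleighQuotient, abs_div, abs_sq]
  exact div_le_of_le_mul₀ (sq_nonneg _) hr₀ hquad

theorem mul_norm_le_norm_sub_smul {b c : ℝ} {u v : K} (h : (u, v) ∈ A.graph)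
    (hu : F.toFun (Ici b) u = u) : (b - c) * ‖u‖ ≤ ‖v - (c : ℂ) • u‖ := by
  have hint : ∫ _, (b - c) ∂(F.scalar u) ≤ ∫ x, (x - c) ∂(F.scalar u) :=
    integral_mono_ae (integrable_const _) ((hF.integrable_id h).sub (integrable_const c)) <|
      (F.ae_mem_of_map_eq_self measurableSet_Ici hu).mono fun x hx => sub_le_sub_right hx c
  have hcs := norm_inner_le_norm (𝕜 := ℂ) u (v - (c : ℂ) • u)
  rw [hF.inner_sub_smul_eq_integral h, norm_real] at hcs
  rw [integral_const, F.scalar_real_univ, smul_eq_mul] at hint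
  rcases (norm_nonneg u).eq_or_lt with hu₀ | hu₀
  · simp [← hu₀]
  · refine le_of_mul_le_mul_left ?_ hu₀
    calc ‖u‖ * ((b - c) * ‖u‖) = ‖u‖ ^ 2 * (b - c) := by ring
      _ ≤ _ := hint.trans ((le_abs_self _).trans hcs)

section Intertwining

variable {L : Type v} [NormedAddCommGroup L] [InnerProductSpace ℂ L] [CompleteSpace L]
  {B : L →ₗ.[ℂ] L} {G : PVM L} {J : K →L[ℂ] L}

/-- With `c` and `r` the centre and the radius of `[a, b]`, the operator `Q = G([E, ∞)) J F(S)`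
satisfies `(E - c) ‖Q‖ ≤ ‖(B - c) Q‖ = ‖Q (A - c) F(S)‖ ≤ r ‖Q‖`, where `r < E - c`. -/
theorem map_Ici_apply_map_eq_zero_of_subset_Icc (hG : IsSpectralMeasure B G)
    (hA : IsSelfAdjoint A) (hB : IsSelfAdjoint B) (hJ : Intertwines J A B) {E a b : ℝ}
    (hab : a ≤ b) (hbE : b < E) (hS : MeasurableSet S) (hSab : S ⊆ Icc a b) (u : K) :
    G.toFun (Ici E) (J (F.toFun S u)) = 0 := by
  set c := (a + b) / 2 with hc
  set r := (b - a) / 2 with hr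
  have hr₀ : 0 ≤ r := by linarith
  have hrE : r < E - c := by linarith
  obtain ⟨C, hCr, hCS, hC⟩ := hF.exists_norm_le_of_subset_closedBall hA hS hr₀
    (hSab.trans (Real.Icc_eq_closedBall a b).subset)
  set Q : K →L[ℂ] L := G.toFun (Ici E) ∘L J ∘L F.toFun S with hQ
  have hQC : ∀ u, (E - c) * ‖Q u‖ ≤ ‖Q (C u)‖ := fun u => by
    have h := hG.mul_norm_le_norm_sub_smul (b := E) (c := c)
      (hG.map_mem_graph hB measurableSet_Ici (hJ (hC u))) (G.map_apply_map measurableSet_Ici _)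
    rw [map_add, map_add, map_smul, map_smul, add_sub_cancel_right] at h
    simpa only [hQ, ContinuousLinearMap.comp_apply, hCS] using h
  have hQr : ‖Q‖ ≤ r * ‖Q‖ / (E - c) :=
    Q.opNorm_le_bound (by have := hr₀.trans_lt hrE; positivity) fun u => by
      rw [div_mul_eq_mul_div, le_div_iff₀' (hr₀.trans_lt hrE)]
      calc (E - c) * ‖Q u‖ ≤ ‖Q (C u)‖ := hQC u
        _ ≤ ‖Q‖ * (r * ‖u‖) := Q.le_opNorm_of_le (C.le_of_opNorm_le hCr u)
        _ = r * ‖Q‖ * ‖u‖ := by ring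
  have hQ₀ : ‖Q‖ = 0 := by
    rw [le_div_iff₀' (hr₀.trans_lt hrE)] at hQr
    nlinarith [norm_nonneg Q]
  exact DFunLike.congr_fun (norm_eq_zero.1 hQ₀) u

theorem map_Ici_apply_map_Iio_eq_zero (hG : IsSpectralMeasure B G) (hA : IsSelfAdjoint A)
    (hB : IsSelfAdjoint B) (hJ : Intertwines J A B) (E : ℝ) (u : K) :
    G.toFun (Ici E) (J (F.toFun (Iio E) u)) = 0 := by
  obtain ⟨a, b, hmono, hab, hU⟩ := exists_monotone_Icc_iUnion_eq_Iio E
  have hlim := VectorMeasure.tendsto_vectorMeasure_iUnion_atTop_nat (v := F.vectorMeasure u)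
    hmono fun n => measurableSet_Icc
  rw [hU, F.vectorMeasure_apply measurableSet_Iio] at hlim
  refine tendsto_nhds_unique (((G.toFun (Ici E) ∘L J).continuous.tendsto _).comp hlim)
    (tendsto_const_nhds.congr fun n => ?_)
  rw [Function.comp_apply, F.vectorMeasure_apply measurableSet_Icc]
  exact (hF.map_Ici_apply_map_eq_zero_of_subset_Icc hG hA hB hJ (hab n).1 (hab n).2
    measurableSet_Icc subset_rfl u).symm

theorem intertwine_map_Iio (hG : IsSpectralMeasure B G) (hA : IsSelfAdjoint A)
    (hB : IsSelfAdjoint B) (hJ : Intertwines J A B) (E : ℝ) (u : K) :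
    J (F.toFun (Iio E) u) = G.toFun (Iio E) (J u) := by
  have hlow : G.toFun (Iio E) (J (F.toFun (Iio E) u)) = J (F.toFun (Iio E) u) := by
    have h := hF.map_Ici_apply_map_Iio_eq_zero hG hA hB hJ E u
    rw [← compl_Iio, G.map_compl measurableSet_Iio] at h
    exact (sub_eq_zero.1 h).symm
  have hhigh : G.toFun (Iio E) (J (F.toFun (Ici E) u)) = 0 := by
    refine ext_inner_left ℂ fun w => ?_
    rw [inner_zero_right, ← G.inner_map_left measurableSet_Iio,
      ← ContinuousLinearMap.adjoint_inner_left, ← F.inner_map_left measurableSet_Ici,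
      hG.map_Ici_apply_map_Iio_eq_zero hF hB hA (hJ.adjoint hA hB) E w, inner_zero_left]
  rw [← compl_Iio, F.map_compl measurableSet_Iio, sub_apply, map_sub, map_sub, hlow,
    sub_eq_zero] at hhigh
  exact hhigh.symm

theorem intertwine_map (hG : IsSpectralMeasure B G) (hA : IsSelfAdjoint A)
    (hB : IsSelfAdjoint B) (hJ : Intertwines J A B) (hS : MeasurableSet S) (u : K) :
    J (F.toFun S u) = G.toFun S (J u) := by
  let Jv : VectorMeasure ℝ L :=
    (F.vectorMeasure u).mapRange J.toLinearMap.toAddMonoidHom J.continuous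
  have hJv : ∀ T, MeasurableSet T → Jv T = J (F.toFun T u) := fun T hT =>
    congrArg J (F.vectorMeasure_apply hT u)
  have hJG : Jv = G.vectorMeasure (J u) := by
    refine VectorMeasure.ext_of_generateFrom (range Iio) ?_ ?_ isPiSystem_Iio ?_
    · rintro _ ⟨E, rfl⟩
      rw [hJv _ measurableSet_Iio, G.vectorMeasure_apply measurableSet_Iio]
      exact hF.intertwine_map_Iio hG hA hB hJ E u
    · rw [← borel_eq_generateFrom_Iio, BorelSpace.measurable_eq (α := ℝ)]
    · rw [hJv _ MeasurableSet.univ, G.vectorMeasure_apply MeasurableSet.univ, F.map_univ,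
        G.map_univ]
      rfl
  rw [← hJv S hS, hJG, G.vectorMeasure_apply hS]

end Intertwining

end IsSpectralMeasure

end Spectral

/-! ### Unitary equivalence -/

section UnitaryEquivalence

universe u

variable {K L : Type u} [NormedAddCommGroup K] [InnerProductSpace ℂ K] [CompleteSpace K]
  [NormedAddCommGroup L] [InnerProductSpace ℂ L] [CompleteSpace L]
  {A : K →ₗ.[ℂ] K} {B : L →ₗ.[ℂ] L} {e : K ≃ₗᵢ[ℂ] L}

theorem IsSpectralProjection.conj_eq {S : Set ℝ} {P : K →L[ℂ] K} {Q : L →L[ℂ] L}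
    (hP : IsSpectralProjection A S P) (hQ : IsSpectralProjection B S Q) (hS : MeasurableSet S)
    (hA : IsSelfAdjoint A) (hB : IsSelfAdjoint B) (he : Intertwines e A B) :
    e.conjStarAlgEquiv P = Q := by
  obtain ⟨F, hF, rfl⟩ := hP
  obtain ⟨G, hG, rfl⟩ := hQ
  ext u
  rw [LinearIsometryEquiv.conjStarAlgEquiv_apply_apply]
  exact (hF.intertwine_map hG hA hB he hS (e.symm u)).trans
    (congrArg (G.toFun S) (e.apply_symm_apply u))

omit [CompleteSpace L] in
theorem mem_opSpectrum_of_mem_graph {B : L →ₗ.[ℂ] L} {z : ℂ} {u : L} (hu : u ≠ 0)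
    (h : (u, z • u) ∈ B.graph) : z ∈ opSpectrum B := by
  rintro ⟨R, -, hR⟩
  refine hu ?_
  rw [← hR _ _ h, sub_self, map_zero]

theorem IsEigenprojection.unique {c : ℝ} {P Q : K →L[ℂ] K} (hP : IsEigenprojection A c P)
    (hQ : IsEigenprojection A c Q) : P = Q := by
  have hrange : ∀ {R : K →L[ℂ] K}, IsEigenprojection A c R → ∀ u,
      u ∈ R.range ↔ (u, (c : ℂ) • u) ∈ A.graph := fun hR u =>
    (LinearMap.IsIdempotentElem.mem_range_iff
      (ContinuousLinearMap.IsIdempotentElem.toLinearMap hR.1.isIdempotentElem)).trans (hR.2 u)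
  refine (ContinuousLinearMap.IsStarProjection.ext_iff hP.1 hQ.1).2 ?_
  ext u
  rw [hrange hP, hrange hQ]

theorem IsEigenprojection.conj {c : ℝ} {P : K →L[ℂ] K} (hP : IsEigenprojection A c P)
    (he : Intertwines e A B) (he' : Intertwines e.symm B A) :
    IsEigenprojection B c (e.conjStarAlgEquiv P) := by
  refine ⟨hP.1.map e.conjStarAlgEquiv, fun u => ?_⟩
  rw [LinearIsometryEquiv.conjStarAlgEquiv_apply_apply, ← e.eq_symm_apply, hP.2]
  exact ⟨fun h => by simpa using he h, fun h => by simpa using he' h⟩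

variable {T : K →L[ℂ] K} {τ τ' : ℂ}

omit [CompleteSpace K] in
theorem HasTrace.neg (h : HasTrace T τ) : HasTrace (-T) (-τ) := fun ι b => by
  simpa using (h ι b).neg

omit [CompleteSpace K] in
theorem hasTrace_neg_iff : HasTrace (-T) τ ↔ HasTrace T (-τ) :=
  ⟨fun h => by simpa using h.neg, fun h => by simpa using h.neg⟩

theorem HasTrace.unique (h : HasTrace T τ) (h' : HasTrace T τ') : τ = τ' := by
  obtain ⟨w, b, -⟩ := exists_hilbertBasis ℂ K
  exact (h w b).unique (h' w b)

theorem HasTrace.trace_eq (h : HasTrace T τ) : trace T = τ := by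
  have hex : ∃ τ, HasTrace T τ := ⟨τ, h⟩
  rw [trace, dif_pos hex]
  exact hex.choose_spec.unique h

variable (T) in
theorem trace_neg : trace (-T) = -trace T := by
  by_cases h : ∃ τ, HasTrace T τ
  · obtain ⟨τ, h⟩ := h
    rw [h.trace_eq, h.neg.trace_eq]
  · have h' : ¬ ∃ τ, HasTrace (-T) τ := fun ⟨τ, hτ⟩ => h ⟨-τ, hasTrace_neg_iff.1 hτ⟩
    rw [trace, trace, dif_neg h, dif_neg h', neg_zero]

theorem HasTrace.conj (h : HasTrace T τ) (e : K ≃ₗᵢ[ℂ] L) :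
    HasTrace (e.conjStarAlgEquiv T) τ := by
  intro ι b
  let b' : HilbertBasis ι ℂ K := HilbertBasis.ofRepr (e.trans b.repr)
  have hb' : ∀ i, e (b' i) = b i := fun i => by
    classical
    rw [← HilbertBasis.repr_symm_single, ← HilbertBasis.repr_symm_single]
    exact e.apply_symm_apply _
  have hdiag : ∀ i, inner ℂ (b' i) (T (b' i)) = inner ℂ (b i) (e.conjStarAlgEquiv T (b i)) :=
    fun i => by
      rw [← hb' i, LinearIsometryEquiv.conjStarAlgEquiv_apply_apply, e.symm_apply_apply,
        e.inner_map_map]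
  simpa only [hdiag] using h ι b'

theorem hasTrace_conj_iff (e : K ≃ₗᵢ[ℂ] L) : HasTrace (e.conjStarAlgEquiv T) τ ↔ HasTrace T τ :=
  ⟨fun h => by simpa [← LinearIsometryEquiv.symm_conjStarAlgEquiv] using h.conj e.symm,
    fun h => h.conj e⟩

theorem trace_conj (e : K ≃ₗᵢ[ℂ] L) (T : K →L[ℂ] K) : trace (e.conjStarAlgEquiv T) = trace T := by
  by_cases h : ∃ τ, HasTrace T τ
  · obtain ⟨τ, h⟩ := h
    rw [h.trace_eq, (h.conj e).trace_eq]
  · rw [trace, trace, dif_neg h, dif_neg (by simpa only [hasTrace_conj_iff] using h)]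

theorem trace_mul_commutator_eq_neg {A B C : K →L[ℂ] K} {A' B' C' : L →L[ℂ] L}
    (hA : A' = e.conjStarAlgEquiv A) (hB : B' = e.conjStarAlgEquiv B)
    (hC : C' = -e.conjStarAlgEquiv C) :
    trace (A' * (B' * C' - C' * B')) = -trace (A * (B * C - C * B)) := by
  rw [← trace_conj e, ← trace_neg, hA, hB, hC]
  simp only [map_mul, map_sub]
  noncomm_ring

end UnitaryEquivalence

variable {d : ℕ}

/-! ### The centered fundamental domain -/

section Lattice

open scoped Pointwise

/-- The parametrization of the lattice generated by `v` by integer coordinates, as a homomorphism;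
its range is the lattice. -/
def latticeHom (v : Fin d → Space d) : (Fin d → ℤ) →+ Space d where
  toFun := latticePoint v
  map_zero' := by simp [latticePoint]
  map_add' m n := by simp [latticePoint, add_smul, Finset.sum_add_distrib]

theorem latticePoint_zero (v : Fin d → Space d) : latticePoint v 0 = 0 :=
  map_zero (latticeHom v)

theorem latticePoint_neg (v : Fin d → Space d) (n : Fin d → ℤ) :
    latticePoint v (-n) = -latticePoint v n :=
  map_neg (latticeHom v) n

theorem latticePoint_sub (v : Fin d → Space d) (m n : Fin d → ℤ) :
    latticePoint v (m - n) = latticePoint v m - latticePoint v n :=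
  map_sub (latticeHom v) m n

instance countable_range_latticeHom (v : Fin d → Space d) : Countable (latticeHom v).range :=
  (latticeHom v).rangeRestrict_surjective.countable

theorem isCompact_cell (v : Fin d → Space d) : IsCompact (cell v) := by
  have h : cell v = (fun ζ : Fin d → ℝ => ∑ l, ζ l • v l) ''
      (univ.pi fun _ => Icc (-(1 / 2) : ℝ) (1 / 2)) := by
    ext x
    simp only [cell, mem_ofPred_eq, mem_image, mem_univ_pi]
    exact exists_congr fun ζ => and_congr_right fun _ => eq_comm
  rw [h]
  exact (isCompact_univ_pi fun _ => isCompact_Icc).image (by fun_prop)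

theorem measurableSet_cell (v : Fin d → Space d) : MeasurableSet (cell v) :=
  (isCompact_cell v).measurableSet

theorem neg_mem_cell_iff {v : Fin d → Space d} {x : Space d} : -x ∈ cell v ↔ x ∈ cell v :=
  Set.ext_iff.1 (neg_preimage_cell v) x

instance isFiniteMeasure_restrict_brillouin (γ : Module.Basis (Fin d) ℝ (Space d)) :
    IsFiniteMeasure (volume.restrict (brillouin γ)) :=
  isFiniteMeasure_restrict.2 (isCompact_cell _).measure_ne_top

variable (b : Module.Basis (Fin d) ℝ (Space d))

theorem repr_latticePoint (n : Fin d → ℤ) (l : Fin d) : b.repr (latticePoint b n) l = n l := by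
  rw [latticePoint, b.repr_sum_self]

theorem latticePoint_injective : Function.Injective (latticePoint b) := fun m n h => by
  ext l
  have := repr_latticePoint b m l
  rw [h, repr_latticePoint] at this
  exact_mod_cast this.symm

theorem mem_cell_iff (x : Space d) :
    x ∈ cell b ↔ ∀ l, b.repr x l ∈ Icc (-(1 / 2) : ℝ) (1 / 2) := by
  constructor
  · rintro ⟨ζ, hζ, rfl⟩ l
    rw [b.repr_sum_self]
    exact hζ l
  · exact fun h => ⟨_, h, (b.sum_repr x).symm⟩

theorem cell_eq_iInter_preimage_coord :
    cell b = ⋂ l, b.coord l ⁻¹' Icc (-(1 / 2) : ℝ) (1 / 2) := by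
  ext x
  simp only [mem_cell_iff, mem_iInter, mem_preimage, Module.Basis.coord_apply]

theorem cell_subset_closure_interior : cell b ⊆ closure (interior (cell b)) := by
  have hconv : Convex ℝ (cell b) := by
    rw [cell_eq_iInter_preimage_coord]
    exact convex_iInter fun l => (convex_Icc _ _).linear_preimage (b.coord l)
  have hint : (0 : Space d) ∈ interior (cell b) := by
    rw [cell_eq_iInter_preimage_coord, mem_interior_iff_mem_nhds]
    refine iInter_mem.2 fun l => ?_
    refine (b.coord l).continuous_of_finiteDimensional.continuousAt.preimage_mem_nhds ?_
    rw [map_zero]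
    exact Icc_mem_nhds (by norm_num) (by norm_num)
  rw [hconv.closure_interior_eq_closure_of_nonempty_interior ⟨0, hint⟩]
  exact subset_closure

theorem exists_sub_latticePoint_mem_cell (x : Space d) : ∃ n, x - latticePoint b n ∈ cell b := by
  refine ⟨fun l => round (b.repr x l), (mem_cell_iff b _).2 fun l => ?_⟩
  rw [map_sub, Finsupp.sub_apply, repr_latticePoint, mem_Icc, ← abs_le]
  exact abs_sub_round _

theorem ae_repr_ne (l : Fin d) (c : ℝ) : ∀ᵐ x : Space d, b.repr x l ≠ c := by
  have hsurj : Function.Surjective (b.coord l) := LinearMap.surjective fun h => by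
    simpa using DFunLike.congr_fun h (b l)
  exact (ae_comp_linearMap_mem_iff (b.coord l) volume volume hsurj
    (measurableSet_singleton c).compl).2 (compl_mem_ae_iff.2 (measure_singleton c))

theorem ae_add_latticePoint_notMem_cell {n : Fin d → ℤ} (hn : n ≠ 0) :
    ∀ᵐ x, x ∈ cell b → x + latticePoint b n ∉ cell b := by
  obtain ⟨l, hl⟩ := Function.ne_iff.1 hn
  filter_upwards [ae_repr_ne b l (1 / 2), ae_repr_ne b l (-(1 / 2))] with x hpos hneg hx hxn
  have hx := (mem_cell_iff b _).1 hx l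
  have hxn := (mem_cell_iff b _).1 hxn l
  rw [map_add, Finsupp.add_apply, repr_latticePoint] at hxn
  rcases lt_or_gt_of_ne hl with h | h
  · have h : (n l : ℝ) ≤ -1 := by exact_mod_cast Int.le_sub_one_of_lt h
    exact hpos (le_antisymm hx.2 (by linarith [hxn.1]))
  · have h : (1 : ℝ) ≤ n l := by exact_mod_cast h
    exact hneg (le_antisymm (by linarith [hxn.2]) hx.1)

theorem isAddFundamentalDomain_cell :
    IsAddFundamentalDomain (latticeHom b).range (cell b) := by
  refine ⟨(measurableSet_cell b).nullMeasurableSet, ae_of_all _ fun x => ?_, ?_⟩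
  · obtain ⟨n, hn⟩ := exists_sub_latticePoint_mem_cell b x
    refine ⟨⟨_, -n, rfl⟩, ?_⟩
    change latticePoint b (-n) + x ∈ cell b
    rwa [latticePoint_neg, neg_add_eq_sub]
  · rintro ⟨_, m, rfl⟩ ⟨_, n, rfl⟩ hmn
    have hnm : m - n ≠ 0 := sub_ne_zero.2 fun h => hmn (by rw [h])
    have h := (measurePreserving_sub_right volume (latticePoint b m)).quasiMeasurePreserving.ae
      (ae_add_latticePoint_notMem_cell b hnm)
    refine measure_mono_null ?_ h
    rintro x ⟨⟨y, hy, hyx⟩, z, hz, hzx⟩ himp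
    have hyx : x - latticePoint b m = y := sub_eq_of_eq_add' hyx.symm
    have hzx : x - latticePoint b n = z := sub_eq_of_eq_add' hzx.symm
    refine himp (hyx ▸ hy) ?_
    rwa [latticePoint_sub, sub_add_sub_cancel, hzx]

end Lattice

/-! ### The dual lattice -/

section DualLattice

variable (γ : Module.Basis (Fin d) ℝ (Space d))

theorem linearIndependent_dualGen : LinearIndependent ℝ (dualGen γ) := by
  rw [Fintype.linearIndependent_iff]
  intro c hc l
  have h := congrArg (fun x => inner ℝ x (γ l)) hc
  simpa [sum_inner, inner_smul_left, inner_dualGen, Real.pi_ne_zero] using h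

/-- The basis of `ℝ^d` formed by the generators of the dual lattice. -/
def dualBasis : Module.Basis (Fin d) ℝ (Space d) :=
  basisOfLinearIndependentOfCardEqFinrank' _ (linearIndependent_dualGen γ) (by simp)

theorem coe_dualBasis : ⇑(dualBasis γ) = dualGen γ :=
  coe_basisOfLinearIndependentOfCardEqFinrank' ..

theorem brillouin_eq_cell_dualBasis : brillouin γ = cell (dualBasis γ) := by
  rw [coe_dualBasis, brillouin]

theorem inner_latticePoint_dualGen (n : Fin d → ℤ) (j : Fin d) :
    inner ℝ (latticePoint γ n) (dualGen γ j) = 2 * Real.pi * n j := by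
  simp_rw [latticePoint, sum_inner, inner_smul_left, real_inner_comm, inner_dualGen]
  simp [mul_comm]

theorem exp_inner_latticePoint (n m : Fin d → ℤ) :
    cexp (I * (inner ℝ (latticePoint γ n) (latticePoint (dualGen γ) m) : ℝ)) = 1 := by
  refine Complex.exp_eq_one_iff.2 ⟨∑ j, m j * n j, ?_⟩
  rw [latticePoint.eq_def (dualGen γ), inner_sum]
  simp_rw [inner_smul_right, inner_latticePoint_dualGen]
  push_cast
  rw [Finset.mul_sum, Finset.sum_mul]
  exact Finset.sum_congr rfl fun j _ => by ring

open scoped Pointwise in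
/-- Translation by `a = γ*_l / (2 n_l)` turns the character into its negative. -/
theorem integral_brillouin_exp_inner {n : Fin d → ℤ} (hn : n ≠ 0) :
    ∫ k in brillouin γ, cexp (I * (inner ℝ (latticePoint γ n) k : ℝ)) = 0 := by
  obtain ⟨l, hl⟩ := Function.ne_iff.1 hn
  set f : Space d → ℂ := fun k => cexp (I * (inner ℝ (latticePoint γ n) k : ℝ))
  set a : Space d := (2 * n l : ℝ)⁻¹ • dualGen γ l
  have hadd : ∀ k k', f (k + k') = f k * f k' := fun k k' => by
    simp only [f, inner_add_right, ofReal_add, mul_add, Complex.exp_add]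
  have hfa : f a = -1 := by
    have : (n l : ℝ) ≠ 0 := Int.cast_ne_zero.2 hl
    have hinner : inner ℝ (latticePoint γ n) a = Real.pi := by
      rw [inner_smul_right, inner_latticePoint_dualGen]
      field_simp
    simp only [f]
    rw [hinner, mul_comm, exp_pi_mul_I]
  have hdom := isAddFundamentalDomain_cell (dualBasis γ)
  rw [← brillouin_eq_cell_dualBasis] at hdom
  have hperiodic : ∀ (g : (latticeHom (dualBasis γ)).range) k, f (g +ᵥ k) = f k := by
    rintro ⟨_, m, rfl⟩ k
    have hone : f (latticePoint (dualBasis γ) m) = 1 := by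
      rw [coe_dualBasis]
      exact exp_inner_latticePoint γ n m
    change f (latticePoint (dualBasis γ) m + k) = f k
    rw [hadd, hone, one_mul]
  have hshift : ∫ k in brillouin γ, f k = ∫ k in brillouin γ, f (a + k) := by
    rw [hdom.setIntegral_eq (hdom.vadd_of_comm a) hperiodic]
    exact (measurePreserving_add_left volume a).setIntegral_image_emb
      (measurableEmbedding_addLeft a) f _
  simp only [hadd, hfa, neg_one_mul, integral_neg] at hshift
  exact self_eq_neg.1 hshift

end DualLattice

section Fiber

variable (γ : Module.Basis (Fin d) ℝ (Space d))

/-! ### Phases and translations in the fibre space -/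

theorem ae_restrict_comp_add_right {p : Space d → Prop} (h : ∀ᵐ x, p x) (a : Space d)
    (s : Set (Space d)) : ∀ᵐ y ∂(volume.restrict s), p (y + a) :=
  ae_restrict_of_ae ((measurePreserving_add_right volume a).quasiMeasurePreserving.ae h)

/-- Multiplication by `y ↦ exp (-i (y + a)·k)` in the fibre space. -/
def shiftPhase (a k : Space d) (u : Fiber γ) : Fiber γ := (memLp_phase (Lp.memLp u) a k).toLp _

theorem coeFn_shiftPhase (a k : Space d) (u : Fiber γ) :
    shiftPhase γ a k u =ᵐ[volume.restrict (cell γ)]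
      fun y => cexp (-(I * (inner ℝ (y + a) k : ℝ))) * u y :=
  MemLp.coeFn_toLp _

theorem coeFn_phase (κ : Space d) (u : Fiber γ) :
    phase γ κ u =ᵐ[volume.restrict (cell γ)] fun y => cexp (-(I * (inner ℝ y κ : ℝ))) * u y := by
  have h := coeFn_shiftPhase γ 0 κ u
  simp only [add_zero] at h
  exact h

/-- The restriction to the fundamental domain of the translate `y ↦ ψ (y + a)`. -/
def translateFiber (ψ : L2Space d) (a : Space d) : Fiber γ := (memLp_translate γ ψ a).toLp _

theorem coeFn_translateFiber (ψ : L2Space d) (a : Space d) :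
    translateFiber γ ψ a =ᵐ[volume.restrict (cell γ)] fun y => ψ (y + a) :=
  MemLp.coeFn_toLp _

theorem coeFn_zakTerm (ψ : L2Space d) (n : Fin d → ℤ) (k : Space d) :
    zakTerm γ ψ n k =ᵐ[volume.restrict (cell γ)] fun y =>
      cexp (-(I * (inner ℝ (y + latticePoint γ n) k : ℝ))) * ψ (y + latticePoint γ n) :=
  MemLp.coeFn_toLp _

theorem zakTerm_eq_shiftPhase (ψ : L2Space d) (n : Fin d → ℤ) (k : Space d) :
    zakTerm γ ψ n k =
      shiftPhase γ (latticePoint γ n) k (translateFiber γ ψ (latticePoint γ n)) := by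
  refine Lp.ext ?_
  filter_upwards [coeFn_zakTerm γ ψ n k, coeFn_translateFiber γ ψ (latticePoint γ n),
    coeFn_shiftPhase γ (latticePoint γ n) k (translateFiber γ ψ (latticePoint γ n))]
    with y hterm htranslate hshift
  rw [hterm, hshift, htranslate]

theorem inner_shiftPhase (a b k : Space d) (u v : Fiber γ) :
    inner ℂ (shiftPhase γ a k u) (shiftPhase γ b k v) =
      cexp (I * (inner ℝ (a - b) k : ℝ)) * inner ℂ u v := by
  rw [L2.inner_def, L2.inner_def, ← integral_const_mul]
  refine integral_congr_ae ?_
  filter_upwards [coeFn_shiftPhase γ a k u, coeFn_shiftPhase γ b k v] with y hu hv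
  have hexp : cexp (I * (inner ℝ (a - b) k : ℝ)) =
      cexp (-(I * (inner ℝ (y + b) k : ℝ))) * cexp (-(-I * (inner ℝ (y + a) k : ℝ))) := by
    rw [← Complex.exp_add, inner_sub_left, inner_add_left, inner_add_left]
    push_cast
    ring_nf
  rw [hu, hv, hexp]
  simp only [RCLike.inner_apply, map_mul, ← exp_conj, map_neg, conj_I, conj_ofReal]
  ring

theorem norm_shiftPhase (a k : Space d) (u : Fiber γ) : ‖shiftPhase γ a k u‖ = ‖u‖ := by
  rw [@norm_eq_sqrt_re_inner ℂ, @norm_eq_sqrt_re_inner ℂ _ _ _ _ u, inner_shiftPhase, sub_self,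
    inner_zero_left, ofReal_zero, mul_zero, Complex.exp_zero, one_mul]

theorem norm_exp_neg_I_mul_sub_le (x y : ℝ) : ‖cexp (-(I * x)) - cexp (-(I * y))‖ ≤ |x - y| := by
  have hfactor : cexp (-(I * x)) - cexp (-(I * y)) =
      cexp (I * (-y : ℝ)) * (cexp (I * (y - x : ℝ)) - 1) := by
    rw [mul_sub, ← Complex.exp_add, mul_one]
    congr 2 <;> push_cast <;> ring
  rw [hfactor, norm_mul, norm_exp_I_mul_ofReal, one_mul, abs_sub_comm]
  exact Real.norm_exp_I_mul_ofReal_sub_one_le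

theorem norm_shiftPhase_sub_le {C : ℝ} (hC : ∀ y ∈ cell γ, ‖y‖ ≤ C) (a k k' : Space d)
    (u : Fiber γ) :
    ‖shiftPhase γ a k u - shiftPhase γ a k' u‖ ≤ (C + ‖a‖) * ‖k - k'‖ * ‖u‖ := by
  refine Lp.norm_le_mul_norm_of_ae_le_mul ?_
  filter_upwards [coeFn_shiftPhase γ a k u, coeFn_shiftPhase γ a k' u,
    Lp.coeFn_sub (shiftPhase γ a k u) (shiftPhase γ a k' u),
    ae_restrict_mem (measurableSet_cell γ)] with y hk hk' hsub hy
  rw [hsub, Pi.sub_apply, hk, hk', ← sub_mul, norm_mul]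
  gcongr
  calc ‖cexp (-(I * (inner ℝ (y + a) k : ℝ))) - cexp (-(I * (inner ℝ (y + a) k' : ℝ)))‖
      ≤ |inner ℝ (y + a) k - inner ℝ (y + a) k'| := norm_exp_neg_I_mul_sub_le _ _
    _ = |inner ℝ (y + a) (k - k')| := by rw [inner_sub_right]
    _ ≤ ‖y + a‖ * ‖k - k'‖ := abs_real_inner_le_norm _ _
    _ ≤ (C + ‖a‖) * ‖k - k'‖ := by
      gcongr
      exact (norm_add_le _ _).trans (add_le_add_left (hC y hy) _)

theorem continuous_shiftPhase (a : Space d) (u : Fiber γ) :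
    Continuous fun k => shiftPhase γ a k u := by
  obtain ⟨C, hCpos, hC⟩ := (isCompact_cell γ).isBounded.exists_pos_norm_le
  refine LipschitzWith.continuous (K := Real.toNNReal ((C + ‖a‖) * ‖u‖)) ?_
  refine LipschitzWith.of_dist_le_mul fun k k' => ?_
  rw [dist_eq_norm, dist_eq_norm, Real.coe_toNNReal _ (by positivity), mul_right_comm]
  exact norm_shiftPhase_sub_le γ hC a k k' u

theorem continuous_phase (u : Fiber γ) : Continuous fun κ => phase γ κ u :=
  continuous_shiftPhase γ 0 u

theorem phase_phase_neg (κ : Space d) (u : Fiber γ) : phase γ κ (phase γ (-κ) u) = u := by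
  refine Lp.ext ?_
  filter_upwards [coeFn_phase γ κ (phase γ (-κ) u), coeFn_phase γ (-κ) u] with y houter hinner
  rw [houter, hinner, ← mul_assoc, ← Complex.exp_add, inner_neg_right]
  simp

theorem phase_neg_phase (κ : Space d) (u : Fiber γ) : phase γ (-κ) (phase γ κ u) = u := by
  simpa only [neg_neg] using phase_phase_neg γ (-κ) u

/-! ### Space reflection -/

theorem ae_comp_neg_cell {p : Space d → Prop} (h : ∀ᵐ y ∂(volume.restrict (cell γ)), p y) :
    ∀ᵐ y ∂(volume.restrict (cell γ)), p (-y) :=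
  (measurePreserving_neg_cell γ).quasiMeasurePreserving.ae h

theorem coeFn_reflection (ψ : L2Space d) : reflection d ψ =ᵐ[volume] fun x => ψ (-x) :=
  Lp.coeFn_compMeasurePreserving ψ (Measure.measurePreserving_neg volume)

theorem coeFn_fiberReflection (u : Fiber γ) :
    fiberReflection γ u =ᵐ[volume.restrict (cell γ)] fun y => u (-y) :=
  Lp.coeFn_compMeasurePreserving u (measurePreserving_neg_cell γ)

theorem fiberReflection_fiberReflection (u : Fiber γ) :
    fiberReflection γ (fiberReflection γ u) = u := by
  refine Lp.ext ?_
  filter_upwards [coeFn_fiberReflection γ (fiberReflection γ u),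
    ae_comp_neg_cell γ (coeFn_fiberReflection γ u)] with y houter hinner
  rw [houter, hinner, neg_neg]

/-- The space reflection in the fibre space as a unitary operator. -/
def fiberReflectionEquiv : Fiber γ ≃ₗᵢ[ℂ] Fiber γ where
  toLinearEquiv := LinearEquiv.ofInvolutive (fiberReflection γ).toLinearMap
    (fiberReflection_fiberReflection γ)
  norm_map' u := Lp.norm_compMeasurePreserving u (measurePreserving_neg_cell γ)

theorem fiberReflectionEquiv_conj (T : Fiber γ →L[ℂ] Fiber γ) :
    (fiberReflectionEquiv γ).conjStarAlgEquiv T = fiberReflection γ * T * fiberReflection γ :=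
  rfl

theorem fiberReflection_phase (κ : Space d) (u : Fiber γ) :
    fiberReflection γ (phase γ κ u) = phase γ (-κ) (fiberReflection γ u) := by
  refine Lp.ext ?_
  filter_upwards [coeFn_fiberReflection γ (phase γ κ u), ae_comp_neg_cell γ (coeFn_phase γ κ u),
    coeFn_phase γ (-κ) (fiberReflection γ u), coeFn_fiberReflection γ u]
    with y hleft hphase hright hu
  rw [hleft, hphase, hright, hu, inner_neg_left, inner_neg_right]

theorem zakTerm_reflection (ψ : L2Space d) (n : Fin d → ℤ) (k : Space d) :
    zakTerm γ (reflection d ψ) n k = fiberReflection γ (zakTerm γ ψ (-n) (-k)) := by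
  refine Lp.ext ?_
  filter_upwards [coeFn_zakTerm γ (reflection d ψ) n k,
    ae_restrict_comp_add_right (coeFn_reflection ψ) (latticePoint γ n) (cell γ),
    coeFn_fiberReflection γ (zakTerm γ ψ (-n) (-k)),
    ae_comp_neg_cell γ (coeFn_zakTerm γ ψ (-n) (-k))] with y hleft hψ hright hterm
  rw [hleft, hψ, hright, hterm, latticePoint_neg, ← neg_add, inner_neg_neg]

/-! ### The Bloch-Floquet-Zak transform -/

theorem continuous_zakTerm (ψ : L2Space d) (n : Fin d → ℤ) : Continuous (zakTerm γ ψ n) := by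
  rw [funext fun k => zakTerm_eq_shiftPhase γ ψ n k]
  exact continuous_shiftPhase γ _ _

theorem memLp_zakTerm (ψ : L2Space d) (n : Fin d → ℤ) :
    MemLp (zakTerm γ ψ n) 2 (volume.restrict (brillouin γ)) := by
  refine MemLp.of_bound (continuous_zakTerm γ ψ n).aestronglyMeasurable
    ‖translateFiber γ ψ (latticePoint γ n)‖ (Eventually.of_forall fun k => ?_)
  rw [zakTerm_eq_shiftPhase, norm_shiftPhase]

/-- The terms of the Bloch-Floquet-Zak transform as elements of `L²(Y*; L²(Y))`. -/
def zakLp (ψ : L2Space d) (n : Fin d → ℤ) : Lp (Fiber γ) 2 (volume.restrict (brillouin γ)) :=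
  (memLp_zakTerm γ ψ n).toLp _

theorem coeFn_zakLp (ψ : L2Space d) (n : Fin d → ℤ) :
    zakLp γ ψ n =ᵐ[volume.restrict (brillouin γ)] zakTerm γ ψ n :=
  MemLp.coeFn_toLp _

theorem inner_zakLp (ψ : L2Space d) (m n : Fin d → ℤ) :
    inner ℂ (zakLp γ ψ m) (zakLp γ ψ n) =
      (∫ k in brillouin γ, cexp (I * (inner ℝ (latticePoint γ (m - n)) k : ℝ))) *
        inner ℂ (translateFiber γ ψ (latticePoint γ m))
          (translateFiber γ ψ (latticePoint γ n)) := by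
  rw [L2.inner_def, ← integral_mul_const]
  refine integral_congr_ae ?_
  filter_upwards [coeFn_zakLp γ ψ m, coeFn_zakLp γ ψ n] with k hm hn
  rw [hm, hn, zakTerm_eq_shiftPhase, zakTerm_eq_shiftPhase, inner_shiftPhase, latticePoint_sub]

theorem norm_sq_zakLp (ψ : L2Space d) (n : Fin d → ℤ) :
    ‖zakLp γ ψ n‖ ^ 2 =
      volume.real (brillouin γ) * ‖translateFiber γ ψ (latticePoint γ n)‖ ^ 2 := by
  have h := inner_zakLp γ ψ n n
  rw [sub_self, latticePoint_zero, inner_self_eq_norm_sq_to_K, inner_self_eq_norm_sq_to_K] at h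
  simp only [inner_zero_left, ofReal_zero, mul_zero, Complex.exp_zero, integral_const,
    measureReal_restrict_apply_univ, real_smul, mul_one] at h
  exact ofReal_injective (by push_cast; exact h)

theorem enorm_translateFiber_sq (ψ : L2Space d) (a : Space d) :
    ‖translateFiber γ ψ a‖ₑ ^ 2 = ∫⁻ y in cell γ, ‖ψ (y + a)‖ₑ ^ 2 := by
  rw [Lp.enorm_def, eLpNorm_congr_ae (coeFn_translateFiber γ ψ a),
    eLpNorm_eq_lintegral_rpow_enorm_toReal two_ne_zero ENNReal.ofNat_ne_top,
    ← ENNReal.rpow_natCast, ← ENNReal.rpow_mul]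
  simp

theorem tsum_enorm_translateFiber_sq_le (ψ : L2Space d) :
    ∑' n, ‖translateFiber γ ψ (latticePoint γ n)‖ₑ ^ 2 ≤ ∫⁻ x, ‖ψ x‖ₑ ^ 2 := by
  let translation (n : Fin d → ℤ) : (latticeHom γ).range := ⟨latticePoint γ (-n), -n, rfl⟩
  have hinj : Function.Injective translation := fun m n h =>
    neg_injective (latticePoint_injective γ (congrArg Subtype.val h))
  rw [(isAddFundamentalDomain_cell γ).lintegral_eq_tsum']
  refine le_of_eq_of_le (tsum_congr fun n => ?_) (ENNReal.tsum_comp_le_tsum_of_injective hinj _)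
  rw [enorm_translateFiber_sq]
  refine lintegral_congr fun y => ?_
  change _ = ‖ψ (-latticePoint γ (-n) + y)‖ₑ ^ 2
  rw [latticePoint_neg, neg_neg, add_comm]

theorem summable_norm_sq_translateFiber (ψ : L2Space d) :
    Summable fun n => ‖translateFiber γ ψ (latticePoint γ n)‖ ^ 2 := by
  have hfinite : ∫⁻ x, ‖ψ x‖ₑ ^ 2 < ∞ := by
    simpa using lintegral_rpow_enorm_lt_top_of_eLpNorm_lt_top two_ne_zero ENNReal.ofNat_ne_top
      (Lp.memLp ψ).2
  have hsum := ENNReal.summable_toReal ((tsum_enorm_translateFiber_sq_le γ ψ).trans_lt hfinite).ne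
  simpa only [ENNReal.toReal_pow, toReal_enorm] using hsum

theorem summable_of_pairwise_inner_eq_zero {𝕜 ι E : Type*} [RCLike 𝕜]
    [NormedAddCommGroup E] [InnerProductSpace 𝕜 E] [CompleteSpace E] {f : ι → E}
    (hf : Pairwise fun i j => inner 𝕜 (f i) (f j) = 0) (hs : Summable fun i => ‖f i‖ ^ 2) :
    Summable f := by
  have hV : OrthogonalFamily 𝕜 (fun i => Submodule.span 𝕜 {f i})
      fun i => (Submodule.span 𝕜 {f i}).subtypeₗᵢ :=
    OrthogonalFamily.of_pairwise fun i j hij => by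
      rw [Function.onFun, Submodule.isOrtho_span]
      simpa using hf hij
  exact (hV.summable_iff_norm_sq_summable
    (fun i => ⟨f i, Submodule.mem_span_singleton_self _⟩)).2 hs

theorem summable_zakLp (ψ : L2Space d) : Summable (zakLp γ ψ) := by
  refine summable_of_pairwise_inner_eq_zero (𝕜 := ℂ) (fun m n hmn => ?_) ?_
  · beta_reduce
    rw [inner_zakLp, integral_brillouin_exp_inner γ (sub_ne_zero.2 hmn), zero_mul]
  · simp only [norm_sq_zakLp]
    exact (summable_norm_sq_translateFiber γ ψ).mul_left _

theorem tendsto_eLpNorm_sub_sum_of_hasSum {ι α E : Type*} [Countable ι] [MeasurableSpace α]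
    {μ : Measure α} [NormedAddCommGroup E] {p : ℝ≥0∞} [Fact (1 ≤ p)] {f : ι → α → E}
    {T : ι → Lp E p μ} (hT : ∀ i, T i =ᵐ[μ] f i) {S : Lp E p μ} (hS : HasSum T S) :
    Tendsto (fun s : Finset ι => eLpNorm (fun x => S x - ∑ i ∈ s, f i x) p μ) atTop (𝓝 0) := by
  have hlim : Tendsto (fun s : Finset ι => ‖S - ∑ i ∈ s, T i‖ₑ) atTop (𝓝 0) := by
    have h := (hS.const_sub S).enorm
    rwa [sub_self, enorm_zero] at h
  refine hlim.congr fun s => ?_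
  rw [Lp.enorm_def]
  refine eLpNorm_congr_ae ?_
  filter_upwards [Lp.coeFn_sub S (∑ i ∈ s, T i), Lp.coeFn_finsetSum s T, ae_all_iff.2 hT]
    with x hsub hsum hterm
  simp only [hsub, Pi.sub_apply, hsum, Finset.sum_apply, hterm]

theorem exists_isZakTransform (ψ : L2Space d) : ∃ Ψ, IsZakTransform γ ψ Ψ :=
  ⟨_, Lp.aestronglyMeasurable _,
    tendsto_eLpNorm_sub_sum_of_hasSum (coeFn_zakLp γ ψ) (summable_zakLp γ ψ).hasSum⟩

theorem measurePreserving_neg_brillouin :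
    MeasurePreserving (fun k : Space d => -k) (volume.restrict (brillouin γ))
      (volume.restrict (brillouin γ)) :=
  measurePreserving_neg_cell _

variable {γ}

theorem IsZakTransform.aestronglyMeasurable_sub_sum {ψ : L2Space d} {Ψ : Space d → Fiber γ}
    (hψ : IsZakTransform γ ψ Ψ) (s : Finset (Fin d → ℤ)) :
    AEStronglyMeasurable (fun k => Ψ k - ∑ n ∈ s, zakTerm γ ψ n k)
      (volume.restrict (brillouin γ)) :=
  hψ.1.sub (continuous_finsetSum _ fun n _ => continuous_zakTerm γ ψ n).aestronglyMeasurable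

theorem IsZakTransform.reflection {ψ : L2Space d} {Ψ : Space d → Fiber γ}
    (hψ : IsZakTransform γ ψ Ψ) :
    IsZakTransform γ (reflection d ψ) fun k => fiberReflection γ (Ψ (-k)) := by
  have hmp := measurePreserving_neg_brillouin γ
  refine ⟨(fiberReflection γ).continuous.comp_aestronglyMeasurable
    (hψ.1.comp_measurePreserving hmp), ?_⟩
  have hneg := (Equiv.neg (Fin d → ℤ)).finsetCongr.toOrderIso
    (fun _ _ => Finset.map_subset_map.2) (fun _ _ => Finset.map_subset_map.2) |>.tendsto_atTop
  refine (hψ.2.comp hneg).congr fun s => ?_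
  have hsum : ∀ k,
      fiberReflection γ (Ψ (-k)) - ∑ n ∈ s, zakTerm γ (BlochFloquet.reflection d ψ) n k =
        fiberReflection γ (Ψ (-k) -
          ∑ n ∈ s.map (Equiv.neg (Fin d → ℤ)).toEmbedding, zakTerm γ ψ n (-k)) := fun k => by
    simp only [zakTerm_reflection, map_sub, map_sum, Finset.sum_map, Equiv.coe_toEmbedding,
      Equiv.neg_apply]
  simp only [hsum]
  rw [Function.comp_apply, ← eLpNorm_comp_measurePreserving (hψ.aestronglyMeasurable_sub_sum _) hmp]
  exact eLpNorm_congr_norm_ae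
    (Eventually.of_forall fun k => ((fiberReflectionEquiv γ).norm_map _).symm)

variable (γ)

/-- The extension by zero of an element of the fibre space. -/
def extendZero (u : Fiber γ) : L2Space d :=
  ((memLp_indicator_iff_restrict (measurableSet_cell γ)).2 (Lp.memLp u)).toLp _

theorem coeFn_extendZero (u : Fiber γ) : extendZero γ u =ᵐ[volume] (cell γ).indicator u :=
  MemLp.coeFn_toLp _

theorem zakTerm_zero_extendZero (u : Fiber γ) (k : Space d) :
    zakTerm γ (extendZero γ u) 0 k = phase γ k u := by
  refine Lp.ext ?_
  filter_upwards [coeFn_zakTerm γ (extendZero γ u) 0 k, coeFn_phase γ k u,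
    ae_restrict_of_ae (coeFn_extendZero γ u), ae_restrict_mem (measurableSet_cell γ)]
    with y hterm hphase hu hy
  rw [hterm, hphase, latticePoint_zero, add_zero, hu, indicator_of_mem hy]

theorem zakTerm_extendZero_of_ne_zero (u : Fiber γ) {n : Fin d → ℤ} (hn : n ≠ 0) (k : Space d) :
    zakTerm γ (extendZero γ u) n k = 0 := by
  refine Lp.ext ?_
  filter_upwards [coeFn_zakTerm γ (extendZero γ u) n k,
    ae_restrict_comp_add_right (coeFn_extendZero γ u) (latticePoint γ n) (cell γ),
    ae_restrict_of_ae (ae_add_latticePoint_notMem_cell γ hn),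
    ae_restrict_mem (measurableSet_cell γ), Lp.coeFn_zero ℂ 2 (volume.restrict (cell γ))]
    with y hterm hu hnotMem hy hzero
  rw [hterm, hu, hzero, indicator_of_notMem (hnotMem hy), mul_zero, Pi.zero_apply]

theorem isZakTransform_extendZero (u : Fiber γ) :
    IsZakTransform γ (extendZero γ u) fun k => phase γ k u := by
  refine ⟨(continuous_phase γ u).aestronglyMeasurable, tendsto_const_nhds.congr' ?_⟩
  filter_upwards [eventually_ge_atTop {0}] with s hs
  have hsum : ∀ k, ∑ n ∈ s, zakTerm γ (extendZero γ u) n k = phase γ k u := fun k => by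
    rw [Finset.sum_eq_single_of_mem 0 (Finset.singleton_subset_iff.1 hs) fun n _ hn =>
      zakTerm_extendZero_of_ne_zero γ u hn k, zakTerm_zero_extendZero]
  simp only [hsum, sub_self, eLpNorm_zero']

theorem zakTerm_add_smul (ψ φ : L2Space d) (c : ℂ) (n : Fin d → ℤ) (k : Space d) :
    zakTerm γ (ψ + c • φ) n k = zakTerm γ ψ n k + c • zakTerm γ φ n k := by
  refine Lp.ext ?_
  filter_upwards [coeFn_zakTerm γ (ψ + c • φ) n k,
    ae_restrict_comp_add_right (Lp.coeFn_add ψ (c • φ)) (latticePoint γ n) (cell γ),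
    ae_restrict_comp_add_right (Lp.coeFn_smul c φ) (latticePoint γ n) (cell γ),
    Lp.coeFn_add (zakTerm γ ψ n k) (c • zakTerm γ φ n k), Lp.coeFn_smul c (zakTerm γ φ n k),
    coeFn_zakTerm γ ψ n k, coeFn_zakTerm γ φ n k]
    with y hleft hadd hsmul hadd' hsmul' hψ hφ
  rw [hleft, hadd, hadd', Pi.add_apply, Pi.add_apply, hsmul, hsmul', Pi.smul_apply, Pi.smul_apply,
    hψ, hφ, smul_eq_mul, smul_eq_mul]
  ring

theorem IsZakTransform.add_smul {ψ φ : L2Space d} {Ψ Φ : Space d → Fiber γ}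
    (hψ : IsZakTransform γ ψ Ψ) (hφ : IsZakTransform γ φ Φ) (c : ℂ) :
    IsZakTransform γ (ψ + c • φ) fun k => Ψ k + c • Φ k := by
  refine ⟨hψ.1.add (hφ.1.const_smul c), ?_⟩
  have hlim := hψ.2.add (ENNReal.Tendsto.const_mul hφ.2 (Or.inr (enorm_ne_top (x := c))))
  rw [mul_zero, add_zero] at hlim
  refine tendsto_of_tendsto_of_tendsto_of_le_of_le tendsto_const_nhds hlim
    (fun _ => zero_le) fun s => ?_
  have hsplit : (fun k => Ψ k + c • Φ k - ∑ n ∈ s, zakTerm γ (ψ + c • φ) n k) =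
      (fun k => Ψ k - ∑ n ∈ s, zakTerm γ ψ n k) +
        c • fun k => Φ k - ∑ n ∈ s, zakTerm γ φ n k := by
    funext k
    simp only [zakTerm_add_smul, Finset.sum_add_distrib, ← Finset.smul_sum, Pi.add_apply,
      Pi.smul_apply]
    module
  rw [hsplit, ← eLpNorm_const_smul]
  exact eLpNorm_add_le (hψ.aestronglyMeasurable_sub_sum s)
    ((hφ.aestronglyMeasurable_sub_sum s).const_smul c) one_le_two

end Fiber

variable {γ : Module.Basis (Fin d) ℝ (Space d)}

/-! ### Reflection symmetry of the fibre operators -/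

namespace IsContinuouslyFibered

variable {H : L2Space d →ₗ.[ℂ] L2Space d} {h : Space d → Fiber γ →ₗ.[ℂ] Fiber γ}

theorem ae_resolvent_fiberReflection (hfib : IsContinuouslyFibered γ H h) (hH : IsSelfAdjoint H)
    (hR : CommutesWithReflection H) {res : Space d → Fiber γ →L[ℂ] Fiber γ}
    (hres : ∀ k, IsResolvent (h k) I (res k)) (u : Fiber γ) :
    ∀ᵐ k ∂(volume.restrict (brillouin γ)),
      fiberReflection γ (res (-k) (phase γ (-k) u)) =
        res k (fiberReflection γ (phase γ (-k) u)) := by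
  obtain ⟨φ, hφ⟩ := exists_mem_graph_add_I_smul hH (extendZero γ u)
  obtain ⟨Φ, hΦ⟩ := exists_isZakTransform γ φ
  have hΨ := (isZakTransform_extendZero γ u).add_smul γ hΦ I
  have hgraph := (hfib.directIntegral _ _ _ _ hΦ hΨ).1 hφ
  have hgraphR := (hfib.directIntegral _ _ _ _ hΦ.reflection hΨ.reflection).1 (hR _ _ hφ)
  have hgraphNeg := (measurePreserving_neg_brillouin γ).quasiMeasurePreserving.ae hgraph
  filter_upwards [hgraphR, hgraphNeg] with k hk hnegk
  have hk := (hres k).2 _ _ hk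
  have hnegk := (hres (-k)).2 _ _ hnegk
  rw [map_add, map_smul, add_sub_cancel_right] at hk
  rw [add_sub_cancel_right] at hnegk
  rw [hk, hnegk]

theorem resolvent_fiberReflection (hfib : IsContinuouslyFibered γ H h) (hH : IsSelfAdjoint H)
    (hR : CommutesWithReflection H) {res : Space d → Fiber γ →L[ℂ] Fiber γ}
    (hcont : Continuous res) (hres : ∀ k, IsResolvent (h k) I (res k)) {k : Space d}
    (hk : k ∈ brillouin γ) (u : Fiber γ) :
    fiberReflection γ (res (-k) u) = res k (fiberReflection γ u) := by
  have hphase : Continuous fun q : Space d => phase γ (-q) (phase γ k u) :=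
    (continuous_phase γ _).comp continuous_neg
  have hsub : brillouin γ ⊆ closure (interior (brillouin γ)) := by
    rw [brillouin_eq_cell_dualBasis]
    exact cell_subset_closure_interior _
  have hkey := Measure.eqOn_of_ae_eq
    (ae_resolvent_fiberReflection hfib hH hR hres (phase γ k u))
    ((fiberReflection γ).continuous.comp
      ((hcont.comp continuous_neg).clm_apply hphase)).continuousOn
    (hcont.clm_apply ((fiberReflection γ).continuous.comp hphase)).continuousOn hsub hk
  simpa only [phase_neg_phase] using hkey

theorem intertwines_of_mem_brillouin (hfib : IsContinuouslyFibered γ H h) (hH : IsSelfAdjoint H)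
    (hR : CommutesWithReflection H) {k : Space d} (hk : k ∈ brillouin γ) :
    Intertwines (fiberReflection γ) (h k) (h (-k)) := by
  obtain ⟨res, hcont, hres⟩ := hfib.continuous
  intro u v huv
  have hcomm := resolvent_fiberReflection hfib hH hR hcont hres (neg_mem_cell_iff.2 hk) (v - I • u)
  rw [neg_neg, (hres k).2 u v huv] at hcomm
  have hmem := (hres (-k)).1 (fiberReflection γ (v - I • u))
  rwa [← hcomm, map_sub, map_smul, sub_add_cancel] at hmem

theorem intertwines_fiberReflection (hfib : IsContinuouslyFibered γ H h) (hH : IsSelfAdjoint H)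
    (hR : CommutesWithReflection H) (k : Space d) :
    Intertwines (fiberReflection γ) (h k) (h (-k)) := by
  obtain ⟨n, hn⟩ := exists_sub_latticePoint_mem_cell (dualBasis γ) k
  rw [← brillouin_eq_cell_dualBasis, coe_dualBasis, sub_eq_add_neg, ← latticePoint_neg] at hn
  intro u v huv
  have hmem := hfib.equivariant _ (-n) _ _
    (hfib.intertwines_of_mem_brillouin hH hR hn (hfib.equivariant _ (-n) _ _ huv))
  simpa only [fiberReflection_phase, latticePoint_neg, neg_neg, phase_neg_phase, neg_add,
    add_neg_cancel_right] using hmem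

end IsContinuouslyFibered

/-! ### Reflection symmetry of the projections -/

section Projections

variable {h : Space d → Fiber γ →ₗ.[ℂ] Fiber γ} {U : Fiber γ ≃ₗᵢ[ℂ] Fiber γ}

/-- The gap makes the set where `e` is even open, and `0` belongs to it. -/
theorem IsIsolatedBand.apply_neg {e : Space d → ℝ} (he : IsIsolatedBand h e)
    (hU : ∀ k, Intertwines U (h k) (h (-k))) (k : Space d) : e (-k) = e k := by
  obtain ⟨g, hg, hgap⟩ := he.gap
  have hcont := he.continuous
  have hspec : ∀ k, (e k : ℂ) ∈ opSpectrum (h (-k)) := fun k => by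
    obtain ⟨u, hu, huk⟩ := he.eigenvalue k
    refine mem_opSpectrum_of_mem_graph ((map_ne_zero_iff U U.injective).2 hu) ?_
    have hmem : (U u, U ((e k : ℂ) • u)) ∈ (h (-k)).graph := hU k huk
    rwa [map_smul] at hmem
  have heq_iff : ∀ k, e (-k) = e k ↔ |e k - e (-k)| < g := fun k => by
    refine ⟨fun heq => by rwa [heq, sub_self, abs_zero], fun hlt => ?_⟩
    by_contra hne
    exact absurd (hgap (-k) _ (hspec k) (Ne.symm hne)) (not_le.2 hlt)
  have hclopen : IsClopen {k | e (-k) = e k} := by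
    refine ⟨isClosed_eq (by fun_prop) hcont, ?_⟩
    simp only [heq_iff]
    exact isOpen_lt (by fun_prop) continuous_const
  exact eq_univ_iff_forall.1 (hclopen.eq_univ ⟨0, by simp⟩) k

theorem IsIsolatedBand.conj_eigenprojection {e : Space d → ℝ} (he : IsIsolatedBand h e)
    (hU : ∀ k, Intertwines U (h k) (h (-k))) (hU' : ∀ k, Intertwines U.symm (h k) (h (-k)))
    {P : Space d → Fiber γ →L[ℂ] Fiber γ} (hP : ∀ k, IsEigenprojection (h k) (e k) (P k))
    (k : Space d) : U.conjStarAlgEquiv (P k) = P (-k) := by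
  have hUsymm : Intertwines U.symm (h (-k)) (h k) := by simpa only [neg_neg] using hU' (-k)
  refine ((hP k).conj (hU k) hUsymm).unique ?_
  rw [← he.apply_neg hU k]
  exact hP (-k)

end Projections

/-! ### Derivatives and symmetries -/

section Derivatives

variable {𝕜 V W : Type*} [NontriviallyNormedField 𝕜] [NormedAddCommGroup V] [NormedSpace 𝕜 V]
  [NormedAddCommGroup W] [NormedSpace 𝕜 W] (L : V ≃L[𝕜] W)

theorem derivWithin_continuousLinearEquiv_comp {J : Set 𝕜} {t : 𝕜}
    (hJ : UniqueDiffWithinAt 𝕜 J t) (f : 𝕜 → V) :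
    derivWithin (fun s => L (f s)) J t = L (derivWithin f J t) :=
  DFunLike.congr_fun (L.comp_fderivWithin (f := f) hJ) 1

theorem lineDeriv_neg_of_comp_neg {E : Type*} [AddCommGroup E] [Module 𝕜 E] {f : E → V}
    {g : E → W} (hfg : ∀ q, g (-q) = L (f q)) (k v : E) :
    lineDeriv 𝕜 g (-k) v = -L (lineDeriv 𝕜 f k v) := by
  have hline : (fun s : 𝕜 => g (-k + s • -v)) = fun s : 𝕜 => L (f (k + s • v)) := by
    funext s
    rw [← hfg, neg_add, smul_neg]
  rw [← neg_eq_iff_eq_neg, ← lineDeriv_neg, lineDeriv, hline, lineDeriv, ← derivWithin_univ,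
    ← derivWithin_univ, derivWithin_continuousLinearEquiv_comp L uniqueDiffWithinAt_univ]

end Derivatives

/-! ### The piezocurvature is odd -/

section Piezocurvature

variable {J : Set ℝ} {P : Space d → ℝ → Fiber γ →L[ℂ] Fiber γ} {t : ℝ}

theorem piezocurvature_neg {U : Fiber γ ≃ₗᵢ[ℂ] Fiber γ} (hJ : UniqueDiffOn ℝ J)
    (hP : ∀ t ∈ J, ∀ k, P (-k) t = U.conjStarAlgEquiv (P k t)) (ht : t ∈ J) (k : Space d) :
    piezocurvature J P (-k) t = -piezocurvature J P k t := by
  let conj : (Fiber γ →L[ℂ] Fiber γ) ≃L[ℝ] (Fiber γ →L[ℂ] Fiber γ) :=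
    U.toContinuousLinearEquiv.conjContinuousAlgEquiv.toContinuousLinearEquiv.restrictScalars ℝ
  funext j
  have htime : derivWithin (fun s => P (-k) s) J t =
      U.conjStarAlgEquiv (derivWithin (fun s => P k s) J t) :=
    (derivWithin_congr (fun s hs => hP s hs k) (hP t ht k)).trans
      (derivWithin_continuousLinearEquiv_comp conj (hJ t ht) _)
  have hspace : lineDeriv ℝ (fun q => P q t) (-k) (EuclideanSpace.single j 1) =
      -U.conjStarAlgEquiv (lineDeriv ℝ (fun q => P q t) k (EuclideanSpace.single j 1)) :=
    lineDeriv_neg_of_comp_neg conj (hP t ht) k _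
  have htrace := trace_mul_commutator_eq_neg (hP t ht k) htime hspace
  exact (congrArg (-I * ·) htrace).trans (mul_neg _ _)

theorem piezoCurrent_eq_zero_of_odd
    (hodd : ∀ k, piezocurvature J P (-k) t = -piezocurvature J P k t) :
    piezoCurrent J P t = 0 := by
  have h := (measurePreserving_neg_brillouin γ).integral_comp
    (MeasurableEquiv.neg (Space d)).measurableEmbedding (fun k => piezocurvature J P k t)
  simp only [hodd] at h
  rw [integral_neg, neg_eq_self] at h
  rw [piezoCurrent, h, smul_zero]

end Piezocurvature

end

end BlochFloquet

theorem mainTheorem4_general {d : ℕ} (γ : Module.Basis (Fin d) ℝ (Space d))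
    (J : Set ℝ) (hJ : UniqueDiffOn ℝ J)
    (H : ℝ → L2Space d →ₗ.[ℂ] L2Space d)
    (h : Space d → ℝ → Fiber γ →ₗ.[ℂ] Fiber γ)
    (hH : ∀ t ∈ J, IsSelfAdjoint (H t))
    (hR : ∀ t ∈ J, CommutesWithReflection (H t))
    (hfib : ∀ t ∈ J, IsContinuouslyFibered γ (H t) (fun k => h k t))
    (P : Space d → ℝ → Fiber γ →L[ℂ] Fiber γ)
    (hP : (∃ S : ℝ → Set ℝ, (∀ t ∈ J, MeasurableSet (S t)) ∧
        ∀ t ∈ J, ∀ k, IsSpectralProjection (h k t) (S t) (P k t)) ∨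
      (∃ e : Space d → ℝ → ℝ, ∀ t ∈ J, IsIsolatedBand (fun k => h k t) (fun k => e k t) ∧
        ∀ k, IsEigenprojection (h k t) (e k t) (P k t))) :
    (∀ t ∈ J, ∀ k, P k t = fiberReflection γ * P (-k) t * fiberReflection γ) ∧
    (∀ t ∈ J, ∀ k, piezocurvature J P (-k) t = -piezocurvature J P k t) ∧
    (∀ t ∈ J, piezoCurrent J P t = 0) := by
  have hinter : ∀ t ∈ J, ∀ k, Intertwines (fiberReflectionEquiv γ) (h k t) (h (-k) t) :=
    fun t ht => (hfib t ht).intertwines_fiberReflection (hH t ht) (hR t ht)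
  have hconj : ∀ t ∈ J, ∀ k, P (-k) t = (fiberReflectionEquiv γ).conjStarAlgEquiv (P k t) := by
    intro t ht k
    have hsa := (hfib t ht).selfAdjoint
    rcases hP with ⟨S, hS, hP⟩ | ⟨e, he⟩
    · exact ((hP t ht k).conj_eq (hP t ht (-k)) (hS t ht) (hsa k) (hsa (-k)) (hinter t ht k)).symm
    · exact ((he t ht).1.conj_eigenprojection (hinter t ht) (hinter t ht) (he t ht).2 k).symm
  have hsymm : ∀ t ∈ J, ∀ k, P k t = fiberReflection γ * P (-k) t * fiberReflection γ :=
    fun t ht k => by simpa only [neg_neg, fiberReflectionEquiv_conj] using hconj t ht (-k)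
  have hodd : ∀ t ∈ J, ∀ k, piezocurvature J P (-k) t = -piezocurvature J P k t :=
    fun t ht => piezocurvature_neg hJ hconj ht
  exact ⟨hsymm, hodd, fun t ht => piezoCurrent_eq_zero_of_odd (hodd t ht)⟩

theorem mainTheorem4 {d : ℕ} (γ : Module.Basis (Fin d) ℝ (Space d))
    (J : Set ℝ) (hJ : UniqueDiffOn ℝ J)
    (H : ℝ → L2Space d →ₗ.[ℂ] L2Space d)
    (h : Space d → ℝ → Fiber γ →ₗ.[ℂ] Fiber γ)
    (hH : ∀ t ∈ J, IsSelfAdjoint (H t))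
    (hR : ∀ t ∈ J, CommutesWithReflection (H t))
    (hfib : ∀ t ∈ J, IsContinuouslyFibered γ (H t) (fun k => h k t))
    (P : Space d → ℝ → Fiber γ →L[ℂ] Fiber γ)
    (hP : (∃ E : ℝ → ℝ, ∀ t ∈ J, ∀ k, IsSpectralProjection (h k t) (Set.Iio (E t)) (P k t)) ∨
      (∃ e : Space d → ℝ → ℝ, ∀ t ∈ J, IsIsolatedBand (fun k => h k t) (fun k => e k t) ∧
        ∀ k, IsEigenprojection (h k t) (e k t) (P k t))) :
    (∀ t ∈ J, ∀ k, P k t = fiberReflection γ * P (-k) t * fiberReflection γ) ∧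
    (∀ t ∈ J, ∀ k, piezocurvature J P (-k) t = -piezocurvature J P k t) ∧
    (∀ t ∈ J, piezoCurrent J P t = 0) :=
  mainTheorem4_general γ J hJ H h hH hR hfib P <|
    hP.imp_left fun ⟨E, hE⟩ => ⟨fun t => Set.Iio (E t), fun _ _ => measurableSet_Iio, hE⟩
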